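/- Let $n\ge 4$. A permutation $\pi=\pi_1\pi_2\cdots\pi_n$ of $\{1,\dots,n\}$ \emph{contains} a permutation $\sigma=\sigma_1\cdots\sigma_m$ of $\{1,\dots,m\}$ if there are indices $i_1<i_2<\cdots<i_m$ such that $\pi_{i_1}\pi_{i_2}\cdots\pi_{i_m}$ is in the same relative order as $\sigma_1\sigma_2\cdots\sigma_m$, and otherwise it is \emph{$\sigma$-avoiding}. For $k\ge 0$ let $s_n^k(\sigma)$ denote the number of $\sigma$-avoiding permutations of $\{1,\dots,n\}$ with exactly $k$ fixed points, so that $s_n^0(\sigma)$ is the number of $\sigma$-avoiding derangements of length $n$. Then $$s_n^0(132)<s_n^0(123).$$ -/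

import Mathlib

namespace PermPattern

/-- The permutation `π` of `{0, …, n - 1}` contains the pattern `σ`: there are positions
`i 0 < i 1 < ⋯ < i (m - 1)` such that the word `π (i 0), …, π (i (m - 1))` is in the same
relative order as the word `σ 0, …, σ (m - 1)`. -/
def Contains {n m : ℕ} (π : Equiv.Perm (Fin n)) (σ : Equiv.Perm (Fin m)) : Prop :=
  ∃ i : Fin m → Fin n, StrictMono i ∧ ∀ a b : Fin m, π (i a) < π (i b) ↔ σ a < σ b

/-- `π` is `σ`-avoiding. -/
def Avoids {n m : ℕ} (π : Equiv.Perm (Fin n)) (σ : Equiv.Perm (Fin m)) : Prop :=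
  ¬ Contains π σ

/-- The number of fixed points of `π`. -/
def fp {n : ℕ} (π : Equiv.Perm (Fin n)) : ℕ :=
  (Finset.univ.filter fun i : Fin n => π i = i).card

/-- `s n k σ` is the number of `σ`-avoiding permutations of length `n` with exactly `k` fixed
points; for `k = 0` this counts the `σ`-avoiding derangements. -/
noncomputable def s (n k : ℕ) {m : ℕ} (σ : Equiv.Perm (Fin m)) : ℕ :=
  Set.ncard {π : Equiv.Perm (Fin n) | Avoids π σ ∧ fp π = k}

/-- The pattern `123`, with one-line notation `0, 1, 2` on `Fin 3`. -/
def p123 : Equiv.Perm (Fin 3) := 1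

/-- The pattern `132`, with one-line notation `0, 2, 1` on `Fin 3`. -/
def p132 : Equiv.Perm (Fin 3) := Equiv.swap 1 2

end PermPattern

namespace PermPattern
open Finset
open scoped Classical

/-! ### Permutations of `{0, …, n - 1}` as functions on `ℕ` -/

/-! Both classes are counted by the Catalan numbers `C n`, so the question is how many avoiders have
a fixed point.

For `132` the count is exact. The entries at or south-west of the smallest fixed point that form a
block with it are a `132`-avoiding derangement followed by that fixed point; deleting the block
leaves an arbitrary `132`-avoider, which has exactly one diagonal corner where the block can return
(`card_av132_eq_add`). With `F` for the derangement series this says `C = F + X F C`, and together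
with `C = 1 + X C²` it gives `C (n+1) = 2 F (n+1) + F n` (`catalan_succ_eq`).

For `123` a lower bound suffices. A fixed point with a smaller entry before it and a larger one
after it would complete a `123`, so each fixed point is a left-to-right minimum or a right-to-left
maximum. Left-to-right minima are equidistributed over the two classes (Simion–Schmidt,
`card_filter_lrMin`), and a `132`-avoider with a fixed left-to-right minimum is recovered from the
permutation with that point deleted. Hence each kind occurs in at most `C (n-1)` permutations, and
there are at least `C n - 2 C (n-1)` derangements, plus the number of permutations of both kinds
(`catalan_add_le`).

Asymptotically `F n` is `4/9` of `C n` and `2 C (n-1)` is half of it, so the bound wins without the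
last term once `n ≥ 13`. For `4 ≤ n ≤ 12` explicit skew sums supply enough permutations of both
kinds. -/

/-- The extension of a permutation of `Fin n` to `ℕ` by the identity. -/
noncomputable def natFun {n : ℕ} (π : Equiv.Perm (Fin n)) (x : ℕ) : ℕ :=
  if h : x < n then π ⟨x, h⟩ else x

theorem natFun_of_lt {n : ℕ} (π : Equiv.Perm (Fin n)) (x : Fin n) : natFun π x = π x := by
  simp [natFun]

theorem natFun_injective (n : ℕ) :
    Function.Injective (natFun : Equiv.Perm (Fin n) → ℕ → ℕ) := by
  intro π σ h
  ext x
  rw [← natFun_of_lt, ← natFun_of_lt, h]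

/-- The permutations of `{0, …, n - 1}`, extended to `ℕ` by the identity. -/
noncomputable def perms (n : ℕ) : Finset (ℕ → ℕ) :=
  univ.map ⟨natFun, natFun_injective n⟩

/-- Functions on `ℕ` give permutations of all lengths one type, so inserting and deleting blocks
needs no casts. Also a permutation of length `b`, read at length `b + 1`, is the same word followed
by its new maximum; both decompositions below use this. -/
theorem mem_perms {n : ℕ} {f : ℕ → ℕ} :
    f ∈ perms n ↔ (∀ x < n, f x < n) ∧ (∀ x < n, ∀ y < n, f x = f y → x = y) ∧
      ∀ x, n ≤ x → f x = x := by
  simp only [perms, mem_map, mem_univ, true_and, Function.Embedding.coeFn_mk]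
  constructor
  · rintro ⟨π, rfl⟩
    refine ⟨fun x hx => ?_, fun x hx y hy h => ?_, fun x hx => ?_⟩
    · simp [natFun, hx]
    · have hx' : natFun π x = π ⟨x, hx⟩ := natFun_of_lt π ⟨x, hx⟩
      have hy' : natFun π y = π ⟨y, hy⟩ := natFun_of_lt π ⟨y, hy⟩
      exact congrArg Fin.val (π.injective (a₁ := ⟨x, hx⟩) (a₂ := ⟨y, hy⟩) (Fin.ext (by omega)))
    · simp [natFun, hx]
  · rintro ⟨h1, h2, h3⟩
    let g : Fin n → Fin n := fun x => ⟨f x, h1 x x.2⟩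
    have hg : Function.Injective g := fun x y h =>
      Fin.ext (h2 x x.2 y y.2 (by simpa [g] using h))
    refine ⟨Equiv.ofBijective g (Finite.injective_iff_bijective.1 hg), ?_⟩
    funext x
    by_cases hx : x < n
    · simp [natFun, hx, g]
    · simp [natFun, hx, h3 x (by omega)]

theorem lt_of_mem_perms {n : ℕ} {f : ℕ → ℕ} (hf : f ∈ perms n) {x : ℕ} (hx : x < n) : f x < n :=
  (mem_perms.1 hf).1 x hx

theorem inj_of_mem_perms {n : ℕ} {f : ℕ → ℕ} (hf : f ∈ perms n) {x y : ℕ} (h : f x = f y) :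
    x = y := by
  obtain ⟨h1, h2, h3⟩ := mem_perms.1 hf
  rcases lt_or_ge x n with hx | hx <;> rcases lt_or_ge y n with hy | hy
  · exact h2 x hx y hy h
  · have := h1 x hx
    have := h3 y hy
    omega
  · have := h1 y hy
    have := h3 x hx
    omega
  · rwa [h3 x hx, h3 y hy] at h

theorem eq_of_mem_perms {n : ℕ} {f : ℕ → ℕ} (hf : f ∈ perms n) {x : ℕ} (hx : n ≤ x) : f x = x :=
  (mem_perms.1 hf).2.2 x hx

theorem exists_of_mem_perms {n : ℕ} {f : ℕ → ℕ} (hf : f ∈ perms n) {y : ℕ} (hy : y < n) :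
    ∃ x < n, f x = y := by
  obtain ⟨π, -, rfl⟩ := mem_map.1 hf
  refine ⟨π.symm ⟨y, hy⟩, Fin.is_lt _, ?_⟩
  simp [natFun_of_lt]

/-- An injective map between integer intervals cannot shrink them. -/
theorem sub_le_sub_of_injective {f : ℕ → ℕ} {a b c d : ℕ}
    (hi : ∀ x y, f x = f y → x = y) (h : ∀ x, a ≤ x → x < b → c ≤ f x ∧ f x < d) :
    b - a ≤ d - c := by
  have := Finset.card_le_card_of_injOn (s := Finset.Ico a b) (t := Finset.Ico c d) f
    (fun x hx => by
      have hx := Finset.mem_Ico.1 (Finset.mem_coe.1 hx)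
      exact Finset.mem_coe.2 (Finset.mem_Ico.2 (h x hx.1 hx.2)))
    (fun x _ y _ hxy => hi x y hxy)
  simpa using this

/-- The `132`-avoiding permutations of `{0, …, n - 1}`. -/
noncomputable def av132 (n : ℕ) : Finset (ℕ → ℕ) :=
  (perms n).filter fun f => ∀ a b c, a < b → b < c → c < n → f a < f c → f c < f b → False

/-- The `123`-avoiding permutations of `{0, …, n - 1}`. -/
noncomputable def av123 (n : ℕ) : Finset (ℕ → ℕ) :=
  (perms n).filter fun f => ∀ a b c, a < b → b < c → c < n → f a < f b → f b < f c → False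

/-- The `132`-avoiding derangements of `{0, …, n - 1}`. -/
noncomputable def der132 (n : ℕ) : Finset (ℕ → ℕ) :=
  (av132 n).filter fun f => ∀ x < n, f x ≠ x

/-- The `123`-avoiding derangements of `{0, …, n - 1}`. -/
noncomputable def der123 (n : ℕ) : Finset (ℕ → ℕ) :=
  (av123 n).filter fun f => ∀ x < n, f x ≠ x

theorem contains_iff {n : ℕ} (π : Equiv.Perm (Fin n)) (σ : Equiv.Perm (Fin 3)) :
    Contains π σ ↔ ∃ a b c : Fin n, a < b ∧ b < c ∧
      (π a < π b ↔ σ 0 < σ 1) ∧ (π b < π a ↔ σ 1 < σ 0) ∧ (π a < π c ↔ σ 0 < σ 2) ∧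
      (π c < π a ↔ σ 2 < σ 0) ∧ (π b < π c ↔ σ 1 < σ 2) ∧ (π c < π b ↔ σ 2 < σ 1) := by
  constructor
  · rintro ⟨i, hi, h⟩
    exact ⟨i 0, i 1, i 2, hi (by decide), hi (by decide), h _ _, h _ _, h _ _, h _ _, h _ _, h _ _⟩
  · rintro ⟨a, b, c, hab, hbc, h1, h2, h3, h4, h5, h6⟩
    refine ⟨![a, b, c], ?_, ?_⟩
    · rw [Fin.strictMono_iff_lt_succ]
      intro i
      fin_cases i <;> simpa
    · intro x y
      match x, y with
      | 0, 0 | 1, 1 | 2, 2 => simp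
      | 0, 1 => exact h1
      | 1, 0 => exact h2
      | 0, 2 => exact h3
      | 2, 0 => exact h4
      | 1, 2 => exact h5
      | 2, 1 => exact h6

theorem fp_eq_zero_iff {n : ℕ} (π : Equiv.Perm (Fin n)) :
    fp π = 0 ↔ ∀ x < n, natFun π x ≠ x := by
  rw [fp, Finset.card_eq_zero, Finset.filter_eq_empty_iff]
  constructor
  · intro h x hx
    have := h (mem_univ ⟨x, hx⟩)
    simpa [natFun, hx, Fin.ext_iff] using this
  · intro h x _ hx
    exact h x x.2 (by rw [natFun_of_lt, hx])

theorem avoids_p132_iff {n : ℕ} (π : Equiv.Perm (Fin n)) :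
    Avoids π p132 ↔ natFun π ∈ av132 n := by
  have h1 : natFun π ∈ perms n := mem_map_of_mem _ (mem_univ π)
  have e0 : p132 0 = 0 := by decide
  have e1 : p132 1 = 2 := by decide
  have e2 : p132 2 = 1 := by decide
  simp only [Avoids, contains_iff, av132, mem_filter, h1, true_and, e0, e1, e2]
  constructor
  · intro h a b c hab hbc hc hac hcb
    apply h
    have ha : a < n := by omega
    have hb : b < n := by omega
    simp only [natFun, ha, hb, hc, dif_pos] at hac hcb
    refine ⟨⟨a, ha⟩, ⟨b, hb⟩, ⟨c, hc⟩, hab, hbc, ?_⟩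
    simp only [Fin.lt_def] at *
    simp
    omega
  · rintro h ⟨a, b, c, hab, hbc, h1, h2, h3, h4, h5, h6⟩
    refine h a b c hab hbc c.2 ?_ ?_ <;> simp only [natFun_of_lt]
    · exact h3.2 (by decide)
    · exact h6.2 (by decide)

theorem avoids_p123_iff {n : ℕ} (π : Equiv.Perm (Fin n)) :
    Avoids π p123 ↔ natFun π ∈ av123 n := by
  have h1 : natFun π ∈ perms n := mem_map_of_mem _ (mem_univ π)
  simp only [Avoids, contains_iff, av123, mem_filter, h1, true_and, p123, Equiv.Perm.one_apply]
  constructor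
  · intro h a b c hab hbc hc hac hcb
    apply h
    have ha : a < n := by omega
    have hb : b < n := by omega
    simp only [natFun, ha, hb, hc, dif_pos] at hac hcb
    refine ⟨⟨a, ha⟩, ⟨b, hb⟩, ⟨c, hc⟩, hab, hbc, ?_⟩
    simp only [Fin.lt_def] at *
    simp
    omega
  · rintro h ⟨a, b, c, hab, hbc, h1, h2, h3, h4, h5, h6⟩
    refine h a b c hab hbc c.2 ?_ ?_ <;> simp only [natFun_of_lt]
    · exact h1.2 (by decide)
    · exact h5.2 (by decide)

theorem s_p132 (n : ℕ) : s n 0 p132 = (der132 n).card := by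
  rw [s, ← Set.ncard_image_of_injective _ (natFun_injective n), ← Set.ncard_coe_finset]
  congr 1
  ext f
  simp only [Set.mem_image, Set.mem_ofPred_eq, der132, coe_filter, avoids_p132_iff, fp_eq_zero_iff]
  constructor
  · rintro ⟨π, h, rfl⟩
    exact h
  · rintro ⟨h1, h2⟩
    obtain ⟨π, -, rfl⟩ := mem_map.1 (mem_filter.1 h1).1
    exact ⟨π, ⟨h1, h2⟩, rfl⟩

theorem s_p123 (n : ℕ) : s n 0 p123 = (der123 n).card := by
  rw [s, ← Set.ncard_image_of_injective _ (natFun_injective n), ← Set.ncard_coe_finset]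
  congr 1
  ext f
  simp only [Set.mem_image, Set.mem_ofPred_eq, der123, coe_filter, avoids_p123_iff, fp_eq_zero_iff]
  constructor
  · rintro ⟨π, h, rfl⟩
    exact h
  · rintro ⟨h1, h2⟩
    obtain ⟨π, -, rfl⟩ := mem_map.1 (mem_filter.1 h1).1
    exact ⟨π, ⟨h1, h2⟩, rfl⟩

/-! ### Inserting and removing a block of consecutive positions and values -/

/-- Insert the word `β` of length `c` into `τ` at position `p` and value `v`. -/
def ins (p v c : ℕ) (β τ : ℕ → ℕ) (x : ℕ) : ℕ :=
  if x < p then (if τ x < v then τ x else τ x + c)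
  else if x < p + c then v + β (x - p)
  else (if τ (x - c) < v then τ (x - c) else τ (x - c) + c)

/-- Remove the `c` positions from `p` on, holding the `c` values from `v` on. -/
def cut (p v c : ℕ) (f : ℕ → ℕ) (x : ℕ) : ℕ :=
  if x < p then (if f x < v then f x else f x - c)
  else (if f (x + c) < v then f (x + c) else f (x + c) - c)

/-- The block of `f` of length `c` at position `p` and value `v`. -/
def blk (p v c : ℕ) (f : ℕ → ℕ) (x : ℕ) : ℕ :=
  if x < c then f (p + x) - v else x

theorem ins_of_lt {p v c : ℕ} {β τ : ℕ → ℕ} {x : ℕ} (h : x < p) :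
    ins p v c β τ x = if τ x < v then τ x else τ x + c := by
  simp [ins, h]

theorem ins_add_of_lt {p v c : ℕ} {β τ : ℕ → ℕ} {x : ℕ} (h : x < c) :
    ins p v c β τ (p + x) = v + β x := by
  simp [ins, h]

theorem ins_add_of_le {p v c : ℕ} {β τ : ℕ → ℕ} {x : ℕ} (h : p ≤ x) :
    ins p v c β τ (x + c) = if τ x < v then τ x else τ x + c := by
  have h1 : ¬ x + c < p := by omega
  have h2 : ¬ x + c < p + c := by omega
  simp [ins, h1, h2]

theorem cases_block (p c x : ℕ) :
    x < p ∨ (∃ y < c, x = p + y) ∨ ∃ y, p ≤ y ∧ x = y + c := by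
  rcases lt_or_ge x p with h | h
  · exact Or.inl h
  rcases lt_or_ge x (p + c) with h' | h'
  · exact Or.inr (Or.inl ⟨x - p, by omega, by omega⟩)
  · exact Or.inr (Or.inr ⟨x - c, by omega, by omega⟩)

theorem perms_mono {m n : ℕ} (h : m ≤ n) : perms m ⊆ perms n := by
  intro f hf
  refine mem_perms.2 ⟨fun x hx => ?_, fun x _ y _ e => inj_of_mem_perms hf e,
    fun x hx => eq_of_mem_perms hf (h.trans hx)⟩
  rcases lt_or_ge x m with h' | h'
  · exact (lt_of_mem_perms hf h').trans_le h
  · rwa [eq_of_mem_perms hf h']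

theorem ins_mem_perms {m c n p v : ℕ} {β τ : ℕ → ℕ} (hβ : β ∈ perms c) (hτ : τ ∈ perms m)
    (hn : m + c = n) (hp : p ≤ m) (hv : v ≤ m) : ins p v c β τ ∈ perms n := by
  subst hn
  refine mem_perms.2 ⟨fun x hx => ?_, fun x hx y hy h => ?_, fun x hx => ?_⟩
  · rcases cases_block p c x with h | ⟨y, h, rfl⟩ | ⟨y, h, rfl⟩
    · rw [ins_of_lt h]
      have := lt_of_mem_perms hτ (h.trans_le hp)
      split_ifs <;> omega
    · rw [ins_add_of_lt h]
      have := lt_of_mem_perms hβ h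
      omega
    · rw [ins_add_of_le h]
      have := lt_of_mem_perms hτ (x := y) (by omega)
      split_ifs <;> omega
  · rcases cases_block p c x with h1 | ⟨x, h1, rfl⟩ | ⟨x, h1, rfl⟩ <;>
      rcases cases_block p c y with h2 | ⟨y, h2, rfl⟩ | ⟨y, h2, rfl⟩
    · rw [ins_of_lt h1, ins_of_lt h2] at h
      apply inj_of_mem_perms hτ
      split_ifs at h <;> omega
    · rw [ins_of_lt h1, ins_add_of_lt h2] at h
      have := lt_of_mem_perms hβ h2
      split_ifs at h <;> omega
    · rw [ins_of_lt h1, ins_add_of_le h2] at h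
      have : x = y := inj_of_mem_perms hτ (by split_ifs at h <;> omega)
      omega
    · rw [ins_of_lt h2, ins_add_of_lt h1] at h
      have := lt_of_mem_perms hβ h1
      split_ifs at h <;> omega
    · rw [ins_add_of_lt h1, ins_add_of_lt h2] at h
      rw [inj_of_mem_perms hβ (Nat.add_left_cancel h)]
    · rw [ins_add_of_lt h1, ins_add_of_le h2] at h
      have := lt_of_mem_perms hβ h1
      split_ifs at h <;> omega
    · rw [ins_of_lt h2, ins_add_of_le h1] at h
      have : x = y := inj_of_mem_perms hτ (by split_ifs at h <;> omega)
      omega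
    · rw [ins_add_of_lt h2, ins_add_of_le h1] at h
      have := lt_of_mem_perms hβ h2
      split_ifs at h <;> omega
    · rw [ins_add_of_le h1, ins_add_of_le h2] at h
      have : x = y := inj_of_mem_perms hτ (by split_ifs at h <;> omega)
      omega
  · obtain ⟨y, rfl⟩ : ∃ y, x = y + c := ⟨x - c, by omega⟩
    rw [ins_add_of_le (by omega), eq_of_mem_perms hτ (by omega)]
    split_ifs <;> omega

theorem cut_mem_perms {m c n p v : ℕ} {f : ℕ → ℕ} (hf : f ∈ perms n) (hn : m + c = n)
    (hp : p ≤ m) (hv : v ≤ m) (hb : ∀ x, p ≤ x ∧ x < p + c ↔ v ≤ f x ∧ f x < v + c) :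
    cut p v c f ∈ perms m := by
  subst hn
  refine mem_perms.2 ⟨fun x hx => ?_, fun x hx y hy h => ?_, fun x hx => ?_⟩
  · have h1 := lt_of_mem_perms hf (x := x) (by omega)
    have h2 := lt_of_mem_perms hf (x := x + c) (by omega)
    have h3 := hb x
    have h4 := hb (x + c)
    unfold cut
    split_ifs <;> omega
  · have h3 := hb x
    have h4 := hb (x + c)
    have h5 := hb y
    have h6 := hb (y + c)
    unfold cut at h
    by_cases h1 : x < p <;> by_cases h2 : y < p <;> simp only [h1, h2, if_true, if_false] at h
    · exact inj_of_mem_perms hf (by split_ifs at h <;> omega)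
    · have : x = y + c := inj_of_mem_perms hf (by split_ifs at h <;> omega)
      omega
    · have : x + c = y := inj_of_mem_perms hf (by split_ifs at h <;> omega)
      omega
    · have : x + c = y + c := inj_of_mem_perms hf (by split_ifs at h <;> omega)
      omega
  · have h2 := eq_of_mem_perms hf (x := x + c) (by omega)
    unfold cut
    rw [h2]
    split_ifs <;> omega

theorem blk_mem_perms {c n p v : ℕ} {f : ℕ → ℕ} (hf : f ∈ perms n)
    (hb : ∀ x, p ≤ x → x < p + c → v ≤ f x ∧ f x < v + c) :
    blk p v c f ∈ perms c := by
  refine mem_perms.2 ⟨fun x hx => ?_, fun x hx y hy h => ?_, fun x hx => ?_⟩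
  · have := hb (p + x) (by omega) (by omega)
    simp only [blk, hx, if_true]
    omega
  · have := hb (p + x) (by omega) (by omega)
    have := hb (p + y) (by omega) (by omega)
    simp only [blk, hx, hy, if_true] at h
    have : p + x = p + y := inj_of_mem_perms hf (by omega)
    omega
  · simp only [blk, hx.not_gt, if_false]

theorem ins_blk_cut {p v c : ℕ} {f β : ℕ → ℕ}
    (hb : ∀ x, p ≤ x ∧ x < p + c ↔ v ≤ f x ∧ f x < v + c) (hβ : ∀ x < c, f (p + x) = v + β x) :
    ins p v c β (cut p v c f) = f := by
  funext x
  rcases cases_block p c x with h | ⟨y, h, rfl⟩ | ⟨y, h, rfl⟩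
  · rw [ins_of_lt h]
    have := hb x
    simp only [cut, h, if_true]
    split_ifs <;> omega
  · rw [ins_add_of_lt h, hβ y h]
  · rw [ins_add_of_le h]
    have := hb (y + c)
    simp only [cut, h.not_gt, if_false]
    split_ifs <;> omega

theorem cut_ins {p v c : ℕ} {β τ : ℕ → ℕ} : cut p v c (ins p v c β τ) = τ := by
  funext x
  unfold cut
  by_cases h : x < p
  · rw [if_pos h, ins_of_lt h]
    split_ifs <;> omega
  · rw [if_neg h, ins_add_of_le (by omega)]
    split_ifs <;> omega

/-- The case in use is `c = b + 1`: the inserted block is `β` followed by a maximum, and only `β` is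
read back. -/
theorem blk_ins {b p v c : ℕ} {β τ : ℕ → ℕ} (hβ : β ∈ perms b) (hbc : b ≤ c) :
    blk p v b (ins p v c β τ) = β := by
  funext x
  unfold blk
  split_ifs with h
  · rw [ins_add_of_lt (by omega)]
    omega
  · rw [eq_of_mem_perms hβ (by omega)]

theorem mem_av132 {n : ℕ} {f : ℕ → ℕ} : f ∈ av132 n ↔ f ∈ perms n ∧
    ∀ a b c, a < b → b < c → c < n → f a < f c → f c < f b → False := by
  simp [av132]

theorem mem_av123 {n : ℕ} {f : ℕ → ℕ} : f ∈ av123 n ↔ f ∈ perms n ∧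
    ∀ a b c, a < b → b < c → c < n → f a < f b → f b < f c → False := by
  simp [av123]

theorem cut_mem_av132 {m c n p v : ℕ} {f : ℕ → ℕ} (hf : f ∈ av132 n) (hn : m + c = n)
    (hp : p ≤ m) (hv : v ≤ m) (hb : ∀ x, p ≤ x ∧ x < p + c ↔ v ≤ f x ∧ f x < v + c) :
    cut p v c f ∈ av132 m := by
  rw [mem_av132] at hf ⊢
  refine ⟨cut_mem_perms hf.1 hn hp hv hb, fun x y z hxy hyz hz h1 h2 => ?_⟩
  -- Closing the gap in the values preserves order off the block, so a pattern in the cut word lifts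
  -- to `f`.
  have key : ∀ x y, cut p v c f x < cut p v c f y →
      f (if x < p then x else x + c) < f (if y < p then y else y + c) := by
    intro x y h
    have h3 := hb x
    have h4 := hb (x + c)
    have h5 := hb y
    have h6 := hb (y + c)
    unfold cut at h
    by_cases h1 : x < p <;> by_cases h2 : y < p <;> simp only [h1, h2, if_true, if_false] at h ⊢ <;>
      split_ifs at h <;> omega
  refine hf.2 _ _ _ ?_ ?_ ?_ (key _ _ h1) (key _ _ h2) <;> split_ifs <;> omega

theorem blk_mem_av132 {c n p v : ℕ} {f : ℕ → ℕ} (hf : f ∈ av132 n) (hn : p + c ≤ n)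
    (hb : ∀ x, p ≤ x → x < p + c → v ≤ f x ∧ f x < v + c) :
    blk p v c f ∈ av132 c := by
  rw [mem_av132] at hf ⊢
  refine ⟨blk_mem_perms hf.1 hb, fun x y z hxy hyz hz h1 h2 => ?_⟩
  have hx : x < c := by omega
  have hy : y < c := by omega
  simp only [blk, hx, hy, hz, if_true] at h1 h2
  have := hb (p + x) (by omega) (by omega)
  have := hb (p + y) (by omega) (by omega)
  have := hb (p + z) (by omega) (by omega)
  exact hf.2 (p + x) (p + y) (p + z) (by omega) (by omega) (by omega) (by omega) (by omega)

theorem av132_succ {b : ℕ} {β : ℕ → ℕ} (h : β ∈ av132 b) : β ∈ av132 (b + 1) := by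
  rw [mem_av132] at h ⊢
  refine ⟨perms_mono (by omega) h.1, fun x y z hxy hyz hz h1 h2 => ?_⟩
  rcases Nat.lt_succ_iff_lt_or_eq.1 hz with h' | rfl
  · exact h.2 x y z hxy hyz h' h1 h2
  · rw [eq_of_mem_perms h.1 le_rfl] at h2
    have := lt_of_mem_perms h.1 hyz
    omega

/-! ### The decomposition of `132`-avoiding permutations around the maximum -/

/-- The first entry of a `132` is its smallest. Since the block lies above all that follows it, an
occurrence starting in the block stays there, and any other lies in `τ`. -/
theorem ins_top_mem_av132 {m c n : ℕ} {β τ : ℕ → ℕ} (hβ : β ∈ av132 c) (hτ : τ ∈ av132 m)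
    (hn : m + c = n) : ins 0 m c β τ ∈ av132 n := by
  rw [mem_av132] at *
  refine ⟨ins_mem_perms hβ.1 hτ.1 hn (by omega) le_rfl, fun x y z hxy hyz hz h1 h2 => ?_⟩
  rcases cases_block 0 c x with h | ⟨x, hx, rfl⟩ | ⟨x, hx, rfl⟩
  · omega
  · rw [ins_add_of_lt hx] at h1
    rcases cases_block 0 c y with h | ⟨y, hy, rfl⟩ | ⟨y, hy, rfl⟩
    · omega
    · rw [ins_add_of_lt hy] at h2
      rcases cases_block 0 c z with h | ⟨z, hz', rfl⟩ | ⟨z, hz', rfl⟩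
      · omega
      · rw [ins_add_of_lt hz'] at h1 h2
        exact hβ.2 x y z (by omega) (by omega) hz' (by omega) (by omega)
      · rw [ins_add_of_le hz'] at h1
        have := lt_of_mem_perms hτ.1 (x := z) (by omega)
        rw [if_pos this] at h1
        omega
    · rw [ins_add_of_le hy] at h2
      have := lt_of_mem_perms hτ.1 (x := y) (by omega)
      rw [if_pos this] at h2
      omega
  · rw [ins_add_of_le hx] at h1
    obtain ⟨y, rfl⟩ : ∃ y', y = y' + c := ⟨y - c, by omega⟩
    obtain ⟨z, rfl⟩ : ∃ z', z = z' + c := ⟨z - c, by omega⟩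
    rw [ins_add_of_le (by omega)] at h1 h2
    rw [ins_add_of_le (by omega)] at h2
    have := lt_of_mem_perms hτ.1 (x := x) (by omega)
    have := lt_of_mem_perms hτ.1 (x := y) (by omega)
    have := lt_of_mem_perms hτ.1 (x := z) (by omega)
    simp only [*, if_true] at h1 h2
    exact hτ.2 x y z (by omega) (by omega) (by omega) h1 h2

/-- An entry before the maximum and a larger one after it would form a `132` with the maximum. So
the first `b + 1` entries exceed all later ones, and counting pins down their values. -/
theorem block_of_max {n b : ℕ} {f : ℕ → ℕ} (hf : f ∈ av132 (n + 1)) (hb : b ≤ n) (h : f b = n)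
    (x : ℕ) : 0 ≤ x ∧ x < 0 + (b + 1) ↔ n - b ≤ f x ∧ f x < n - b + (b + 1) := by
  rw [mem_av132] at hf
  have lt_n : ∀ x ≤ n, x ≠ b → f x < n := fun x hx hxb => by
    have := lt_of_mem_perms hf.1 (x := x) (by omega)
    have : f x ≠ n := fun e => hxb (inj_of_mem_perms hf.1 (e.trans h.symm))
    omega
  have key : ∀ x y, x ≤ b → b < y → y ≤ n → f y < f x := by
    intro x y hx hy hyn
    rcases hx.lt_or_eq with hx | rfl
    · by_contra hc
      have hne : f x ≠ f y := fun e => by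
        have := inj_of_mem_perms hf.1 e
        omega
      exact hf.2 x b y hx hy (by omega) (by omega) (h ▸ lt_n y hyn (by omega))
    · rw [h]
      exact lt_n y hyn (by omega)
  have hi : ∀ x y, f x = f y → x = y := fun x y => inj_of_mem_perms hf.1
  constructor
  · intro hx
    have h1 := sub_le_sub_of_injective (a := b + 1) (b := n + 1) (c := 0) (d := f x) hi
      (fun y h1 h2 => ⟨by omega, key x y (by omega) (by omega) (by omega)⟩)
    have := lt_of_mem_perms hf.1 (x := x) (by omega)
    omega
  · intro hx
    by_contra hc
    rcases le_or_gt x n with hxn | hxn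
    · have h1 := sub_le_sub_of_injective (a := 0) (b := b + 1) (c := f x + 1) (d := n + 1) hi
        (fun y h1 h2 => ⟨key y x (by omega) (by omega) (by omega),
          lt_of_mem_perms hf.1 (by omega)⟩)
      omega
    · have := eq_of_mem_perms hf.1 (x := x) (by omega)
      omega

theorem card_av132_succ (n : ℕ) :
    (av132 (n + 1)).card = ∑ b ∈ range (n + 1), (av132 b).card * (av132 (n - b)).card := by
  simp_rw [← card_product]
  rw [← card_sigma]
  symm
  refine card_bij (fun t _ => ins 0 (n - t.1) (t.1 + 1) t.2.1 t.2.2) ?_ ?_ ?_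
  · rintro ⟨b, β, τ⟩ ht
    simp only [mem_sigma, mem_range, mem_product] at ht
    exact ins_top_mem_av132 (av132_succ ht.2.1) ht.2.2 (by dsimp only; omega)
  · rintro ⟨b, β, τ⟩ ht ⟨b', β', τ'⟩ ht' h
    simp only [mem_sigma, mem_range, mem_product] at ht ht'
    dsimp only at h
    -- The extension of `β` fixes `b`, so the maximum sits at position `b`, and the image determines
    -- `b`.
    have h1 : ins 0 (n - b) (b + 1) β τ (0 + b) = n := by
      rw [ins_add_of_lt (by omega), eq_of_mem_perms (mem_av132.1 ht.2.1).1 le_rfl]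
      omega
    have h2 : ins 0 (n - b') (b' + 1) β' τ' (0 + b') = n := by
      rw [ins_add_of_lt (by omega), eq_of_mem_perms (mem_av132.1 ht'.2.1).1 le_rfl]
      omega
    rw [← h] at h2
    have h3 : ins 0 (n - b) (b + 1) β τ ∈ av132 (n + 1) :=
      ins_top_mem_av132 (av132_succ ht.2.1) ht.2.2 (by omega)
    have : 0 + b = 0 + b' := inj_of_mem_perms (mem_av132.1 h3).1 (h1.trans h2.symm)
    obtain rfl : b = b' := by omega
    have e1 := congrArg (blk 0 (n - b) b) h
    have e2 := congrArg (cut 0 (n - b) (b + 1)) h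
    rw [blk_ins (mem_av132.1 ht.2.1).1 (by omega),
      blk_ins (mem_av132.1 ht'.2.1).1 (by omega)] at e1
    rw [cut_ins, cut_ins] at e2
    rw [e1, e2]
  · intro f hf
    obtain ⟨b, hb, hfb⟩ := exists_of_mem_perms (mem_av132.1 hf).1 (y := n) (by omega)
    have hB := block_of_max hf (by omega) hfb
    have hB' : ∀ x, 0 ≤ x → x < 0 + b → n - b ≤ f x ∧ f x < n - b + b := fun x _ hx => by
      have := (hB x).1 ⟨by omega, by omega⟩
      have : f x ≠ n := fun e => by
        have := inj_of_mem_perms (mem_av132.1 hf).1 (e.trans hfb.symm)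
        omega
      omega
    refine ⟨⟨b, blk 0 (n - b) b f, cut 0 (n - b) (b + 1) f⟩, ?_, ?_⟩
    · simp only [mem_sigma, mem_range, mem_product]
      exact ⟨hb, blk_mem_av132 hf (by omega) hB',
        cut_mem_av132 hf (by omega) (by omega) le_rfl hB⟩
    · refine ins_blk_cut hB fun x hx => ?_
      dsimp only at hx ⊢
      unfold blk
      split_ifs with h
      · have := hB' (0 + x) (by omega) (by omega)
        omega
      · obtain rfl : x = b := by omega
        rw [zero_add, hfb]
        omega

theorem card_av132 (n : ℕ) : (av132 n).card = catalan n := by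
  induction n using Nat.strong_induction_on with
  | _ n ih =>
    cases n with
    | zero =>
      have : av132 0 = {id} := by
        ext f
        simp only [mem_av132, mem_perms, mem_singleton]
        constructor
        · rintro ⟨h, -⟩
          funext x
          exact h.2.2 x (Nat.zero_le x)
        · rintro rfl
          simp
      simp [this]
    | succ n =>
      rw [card_av132_succ, catalan_succ, ← Fin.sum_univ_eq_sum_range
        (fun b => (av132 b).card * (av132 (n - b)).card)]
      refine Finset.sum_congr rfl fun b _ => ?_
      rw [ih b (by omega), ih (n - b) (by omega)]

/-! ### The decomposition of `132`-avoiding permutations around the smallest fixed point -/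

/-- The diagonal corner `k` has no point of `τ` to its south-west, and the points of `τ` to its
north-east are increasing. -/
def IsCorner (m : ℕ) (τ : ℕ → ℕ) (k : ℕ) : Prop :=
  k ≤ m ∧ (∀ x < k, k ≤ τ x) ∧
    ∀ x y, k ≤ x → x < y → y < m → k ≤ τ x → k ≤ τ y → τ x < τ y

/-- If `k < l` were both corners, position `k` would hold a value at least `l` and value `k` would
sit at position `l` or later: a descent north-east of `k`. -/
theorem IsCorner.le {m : ℕ} {τ : ℕ → ℕ} (hτ : τ ∈ perms m) {k l : ℕ} (hk : IsCorner m τ k)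
    (hl : IsCorner m τ l) : l ≤ k := by
  by_contra! h
  obtain ⟨y, hy, e⟩ := exists_of_mem_perms hτ (y := k) (by have := hl.1; omega)
  have h1 := hl.2.1 k h
  have h2 : l ≤ y := by
    by_contra hc
    have := hl.2.1 y (by omega)
    omega
  have := hk.2.2 k y le_rfl (by omega) hy (by omega) e.ge
  omega

theorem IsCorner.eq {m : ℕ} {τ : ℕ → ℕ} (hτ : τ ∈ perms m) {k l : ℕ} (hk : IsCorner m τ k)
    (hl : IsCorner m τ l) : k = l :=
  le_antisymm (hl.le hτ hk) (hk.le hτ hl)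

/-- Take the least `k` such that some point has both coordinates at most `k`. Nothing lies
south-west of `k` by minimality, and that point would complete a `132` with any descent to the
north-east. -/
theorem exists_isCorner {m : ℕ} {τ : ℕ → ℕ} (hτ : τ ∈ av132 m) : ∃ k, IsCorner m τ k := by
  rw [mem_av132] at hτ
  by_cases h : ∀ x < m, m ≤ τ x
  · exact ⟨m, le_rfl, h, fun x y h1 h2 h3 => by omega⟩
  push Not at h
  have hex : ∃ k, ∃ x ≤ k, τ x ≤ k := by
    obtain ⟨x, hx, hx'⟩ := h
    exact ⟨m, x, hx.le, hx'.le⟩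
  obtain ⟨x, hx, hxk⟩ := Nat.find_spec hex
  have hmin : ∀ y < Nat.find hex, Nat.find hex ≤ τ y := fun y hy => by
    by_contra hc
    exact Nat.find_min hex (m := Nat.find hex - 1) (by omega) ⟨y, by omega, by omega⟩
  set k := Nat.find hex
  have hkm : k ≤ m := Nat.find_min' hex (by
    obtain ⟨x, hx, hx'⟩ := h
    exact ⟨x, hx.le, hx'.le⟩)
  refine ⟨k, hkm, hmin, fun y z hy hyz hz h1 h2 => ?_⟩
  by_contra hc
  have hne : τ y ≠ τ z := fun e => by
    have := inj_of_mem_perms hτ.1 e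
    omega
  have hxz : x ≠ z := by
    rintro rfl
    omega
  rcases eq_or_ne x y with rfl | hxy
  · omega
  have hne' : τ x ≠ τ z := fun e => hxz (inj_of_mem_perms hτ.1 e)
  exact hτ.2 x y z (by omega) hyz hz (by omega) (by omega)

/-- A mixed `132` cannot start before the block, as those entries lie above it, nor after it. If it
starts in the block, its last entry is in the block or north-east of it, and the north-east entries
increase. -/
theorem ins_corner_mem_av132 {m c n k : ℕ} {β τ : ℕ → ℕ} (hβ : β ∈ av132 c) (hτ : τ ∈ av132 m)
    (hn : m + c = n) (hk : IsCorner m τ k) : ins k k c β τ ∈ av132 n := by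
  obtain ⟨hkm, hk1, hk2⟩ := hk
  rw [mem_av132] at *
  refine ⟨ins_mem_perms hβ.1 hτ.1 hn hkm hkm, fun x y z hxy hyz hz h1 h2 => ?_⟩
  rcases cases_block k c x with hx | ⟨x, hx, rfl⟩ | ⟨x, hx, rfl⟩ <;>
    rcases cases_block k c y with hy | ⟨y, hy, rfl⟩ | ⟨y, hy, rfl⟩ <;>
    rcases cases_block k c z with hz' | ⟨z, hz', rfl⟩ | ⟨z, hz', rfl⟩ <;> try omega
  all_goals
    simp only [ins_of_lt, ins_add_of_lt, ins_add_of_le, hx, hy, hz'] at h1 h2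
  · exact hτ.2 x y z hxy hyz (by omega) (by split_ifs at * <;> omega)
      (by split_ifs at * <;> omega)
  · have := hk1 x hx
    have := lt_of_mem_perms hβ.1 hz'
    split_ifs at * <;> omega
  · exact hτ.2 x y z hxy (by omega) (by omega) (by split_ifs at * <;> omega)
      (by split_ifs at * <;> omega)
  · have := hk1 x hx
    have := lt_of_mem_perms hβ.1 hz'
    split_ifs at * <;> omega
  · have := hk1 x hx
    have := lt_of_mem_perms hβ.1 hy
    split_ifs at * <;> omega
  · exact hτ.2 x y z (by omega) (by omega) (by omega) (by split_ifs at * <;> omega)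
      (by split_ifs at * <;> omega)
  · exact hβ.2 x y z (by omega) (by omega) hz' (by omega) (by omega)
  · have := lt_of_mem_perms hβ.1 hx
    have := lt_of_mem_perms hβ.1 hy
    split_ifs at * <;> omega
  · have := lt_of_mem_perms hβ.1 hx
    have := hk2 y z hy (by omega) (by omega)
    split_ifs at * <;> omega
  · exact hτ.2 x y z (by omega) (by omega) (by omega) (by split_ifs at * <;> omega)
      (by split_ifs at * <;> omega)

/-- With `k` the first position of a value at most `i`, the block occupies positions and values from
`k` to `i`. A larger entry between `k` and `i` gives a `132` with the two ends; an entry after `i`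
with value below `i` but above a block entry gives a `132` with that entry and `i`. -/
theorem exists_block_of_fixed {n i : ℕ} {f : ℕ → ℕ} (hf : f ∈ av132 n) (hi : i < n)
    (h : f i = i) : ∃ k b, k + b = i ∧ (∀ x < k, i < f x) ∧
      ∀ x, k ≤ x ∧ x < k + (b + 1) ↔ k ≤ f x ∧ f x < k + (b + 1) := by
  rw [mem_av132] at hf
  have hinj : ∀ x y, f x = f y → x = y := fun x y => inj_of_mem_perms hf.1
  have hex : ∃ k, f k ≤ i := ⟨i, h.le⟩
  have hfk := Nat.find_spec hex
  have hmin : ∀ x < Nat.find hex, i < f x := fun x hx => not_le.1 (Nat.find_min hex hx)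
  have hki : Nat.find hex ≤ i := Nat.find_min' hex h.le
  set k := Nat.find hex
  have h1 : ∀ x, k ≤ x → x ≤ i → f x ≤ i := by
    intro x hx hxi
    by_contra hc
    have hkx : k ≠ x := by
      rintro rfl
      omega
    have hxi' : x ≠ i := by
      rintro rfl
      omega
    have hki' : f k ≠ f i := fun e => by
      have := hinj _ _ e
      omega
    exact hf.2 k x i (by omega) (by omega) hi (by omega) (by omega)
  have h2 : ∀ x y, k ≤ x → x ≤ i → i < y → y < n → f y < i → f y < f x := by
    intro x y hkx hxi hy hyn hyi
    by_contra hc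
    have hne : f x ≠ f y := fun e => by
      have := hinj _ _ e
      omega
    have hxi' : x ≠ i := by
      rintro rfl
      omega
    exact hf.2 x i y (by omega) hy hyn (by omega) (by omega)
  have h3 : ∀ x, k ≤ x → x ≤ i → k ≤ f x := by
    intro x hkx hxi
    -- Every value from `f x` to `i` is taken at a position from `k` to `i`, so there are at most as
    -- many such values as positions; this forces `k ≤ f x`.
    choose! g hg hgf using fun y => exists_of_mem_perms hf.1 (y := y)
    have := Finset.card_le_card_of_injOn (s := Finset.Icc (f x) i) (t := Finset.Icc k i) g
      (fun y hy => by
        rw [Finset.coe_Icc, Set.mem_Icc] at hy ⊢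
        have hyn : y < n := by omega
        have e := hgf y hyn
        have := hg y hyn
        constructor
        · by_contra hc
          have := hmin (g y) (by omega)
          omega
        · by_contra hc
          have : f (g y) ≠ f i := fun e => by
            have := hinj _ _ e
            omega
          have := h2 x (g y) hkx hxi (by omega) (by omega) (by omega)
          omega)
      (fun y hy z hz e => by
        rw [Finset.coe_Icc, Set.mem_Icc] at hy hz
        rw [← hgf y (by omega), ← hgf z (by omega), e])
    simp only [Nat.card_Icc] at this
    have := h1 x hkx hxi
    omega
  refine ⟨k, i - k, by omega, hmin, fun x => ⟨fun hx => ?_, fun hx => ?_⟩⟩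
  · have := h1 x (by omega) (by omega)
    have := h3 x (by omega) (by omega)
    omega
  · by_contra hc
    rcases lt_or_ge x k with hxk | hxk
    · have := hmin x hxk
      omega
    rcases lt_or_ge x n with hxn | hxn
    · have hne : f x ≠ f i := fun e => by
        have := hinj _ _ e
        omega
      have := sub_le_sub_of_injective (a := k) (b := i + 1) (c := f x + 1) (d := i + 1) hinj
        (fun y hy1 hy2 => by
          have := h2 y x hy1 (by omega) (by omega) hxn (by omega)
          have := h1 y hy1 (by omega)
          omega)
      omega
    · have := eq_of_mem_perms hf.1 hxn
      omega

/-- Entries before the block exceed it by `hk`, and a descent north-east of the fixed point would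
form a `132` with it. -/
theorem isCorner_cut {n k b : ℕ} {f : ℕ → ℕ} (hf : f ∈ av132 n) (hi : k + b < n)
    (h : f (k + b) = k + b) (hk : ∀ x < k, k + b < f x)
    (hB : ∀ x, k ≤ x ∧ x < k + (b + 1) ↔ k ≤ f x ∧ f x < k + (b + 1)) :
    IsCorner (n - 1 - b) (cut k k (b + 1) f) k := by
  rw [mem_av132] at hf
  have h1 := sub_le_sub_of_injective (f := f) (a := 0) (b := k) (c := k + b + 1) (d := n)
    (fun x y => inj_of_mem_perms hf.1)
    (fun x _ hx => ⟨hk x hx, lt_of_mem_perms hf.1 (by omega)⟩)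
  refine ⟨by omega, fun x hx => ?_, fun x y hkx hxy hy h2 h3 => ?_⟩
  · have := hk x hx
    simp only [cut, hx, if_true]
    split_ifs <;> omega
  · have hx' : ¬ x < k := by omega
    have hy' : ¬ y < k := by omega
    have := hB (x + (b + 1))
    have := hB (y + (b + 1))
    have hlt := hf.2 (k + b) (x + (b + 1)) (y + (b + 1)) (by omega) (by omega) (by omega)
    have hne : f (x + (b + 1)) ≠ f (y + (b + 1)) := fun e => by
      have := inj_of_mem_perms hf.1 e
      omega
    simp only [cut, hx', hy', if_false] at h2 h3 ⊢
    rw [h] at hlt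
    have hlt' : k + b < f (y + (b + 1)) → f (x + (b + 1)) < f (y + (b + 1)) := fun h' => by
      by_contra hc
      exact hlt h' (by omega)
    split_ifs at h2 h3 ⊢ <;> omega

/-- The number of `132`-avoiding permutations with a fixed point, counted by the `132`-avoiding
derangement lying to the south-west of the smallest fixed point. -/
theorem card_av132_eq_add (n : ℕ) : (av132 n).card =
    (der132 n).card + ∑ b ∈ range n, (der132 b).card * (av132 (n - 1 - b)).card := by
  rw [der132, ← Finset.card_filter_add_card_filter_not (fun f => ∀ x < n, f x ≠ x)]
  congr 1
  simp_rw [← card_product]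
  rw [← card_sigma]
  symm
  choose! κ hκ using fun m τ => exists_isCorner (m := m) (τ := τ)
  have mem : ∀ t ∈ (range n).sigma fun b => der132 b ×ˢ av132 (n - 1 - b),
      ins (κ (n - 1 - t.1) t.2.2) (κ (n - 1 - t.1) t.2.2) (t.1 + 1) t.2.1 t.2.2 ∈ av132 n := by
    rintro ⟨b, β, τ⟩ ht
    simp only [mem_sigma, mem_range, mem_product, der132, mem_filter] at ht
    exact ins_corner_mem_av132 (av132_succ ht.2.1.1) ht.2.2 (by dsimp only; omega)
      (hκ _ _ ht.2.2)
  -- The smallest fixed point of the image is the last point of the block: earlier block entries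
  -- form a derangement, and entries before the block lie above the diagonal. The last clause serves
  -- to recover where the block starts.
  have fixed : ∀ t ∈ (range n).sigma fun b => der132 b ×ˢ av132 (n - 1 - b),
      ∃ k i, k = κ (n - 1 - t.1) t.2.2 ∧ k + t.1 = i ∧ i < n ∧
      ins k k (t.1 + 1) t.2.1 t.2.2 i = i ∧
      (∀ x < i, ins k k (t.1 + 1) t.2.1 t.2.2 x ≠ x) ∧
      ∀ x, k ≤ x → x < i → ins k k (t.1 + 1) t.2.1 t.2.2 x < i := by
    rintro ⟨b, β, τ⟩ ht
    simp only [mem_sigma, mem_range, mem_product, der132, mem_filter] at ht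
    obtain ⟨hk1, hk2, -⟩ := hκ _ _ ht.2.2
    refine ⟨_, _, rfl, rfl, ?_, ?_, fun x hx => ?_, fun x hx hx' => ?_⟩
    · dsimp only
      omega
    · dsimp only
      rw [ins_add_of_lt (by omega), eq_of_mem_perms (mem_av132.1 ht.2.1.1).1 le_rfl]
    · dsimp only at hx ⊢
      rcases lt_or_ge x (κ (n - 1 - b) τ) with h | h
      · rw [ins_of_lt h]
        have := hk2 x h
        split_ifs <;> omega
      · obtain ⟨x, rfl⟩ := Nat.exists_eq_add_of_le h
        rw [ins_add_of_lt (by omega)]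
        have := ht.2.1.2 x (by omega)
        omega
    · dsimp only at hx hx' ⊢
      obtain ⟨x, rfl⟩ := Nat.exists_eq_add_of_le hx
      rw [ins_add_of_lt (by omega)]
      have := lt_of_mem_perms (mem_av132.1 ht.2.1.1).1 (x := x) (by omega)
      omega
  refine card_bij (fun t _ => ins (κ (n - 1 - t.1) t.2.2) (κ (n - 1 - t.1) t.2.2) (t.1 + 1)
    t.2.1 t.2.2) ?_ ?_ ?_
  · intro t ht
    obtain ⟨k, i, rfl, -, hi, h, -⟩ := fixed t ht
    exact mem_filter.2 ⟨mem t ht, fun hd => hd i hi h⟩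
  · rintro ⟨b, β, τ⟩ ht ⟨b', β', τ'⟩ ht' h
    -- Only inequalities are proved; applied in both directions they show that block length and
    -- corner agree.
    have key : ∀ t ∈ (range n).sigma fun b => der132 b ×ˢ av132 (n - 1 - b),
        ∀ t' ∈ (range n).sigma fun b => der132 b ×ˢ av132 (n - 1 - b), ins (κ (n - 1 - t.1) t.2.2) (κ (n - 1 - t.1) t.2.2) (t.1 + 1)
        t.2.1 t.2.2 = ins (κ (n - 1 - t'.1) t'.2.2) (κ (n - 1 - t'.1) t'.2.2) (t'.1 + 1)
        t'.2.1 t'.2.2 → t'.1 ≤ t.1 ∧ κ (n - 1 - t.1) t.2.2 ≤ κ (n - 1 - t'.1) t'.2.2 := by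
      intro t ht t' ht' h
      have hc := hκ (n - 1 - t.1) t.2.2 (by
        simp only [mem_sigma, mem_product] at ht
        exact ht.2.2)
      obtain ⟨k, i, hk, hki, hi, h1, h2, h3⟩ := fixed t ht
      obtain ⟨k', i', hk', hki', hi', h1', h2', h3'⟩ := fixed t' ht'
      rw [← hk, ← hk'] at h ⊢
      rw [← hk] at hc
      rw [← h] at h1' h2' h3'
      have e : i = i' := by
        rcases lt_trichotomy i i' with hlt | rfl | hlt
        · exact absurd h1 (h2' i hlt)
        · rfl
        · exact absurd h1' (h2 i' hlt)
      subst e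
      have : k ≤ k' := by
        by_contra! hlt
        have h4 := h3' k' le_rfl (by omega)
        rw [ins_of_lt hlt] at h4
        have := hc.2.1 k' hlt
        split_ifs at h4 <;> omega
      omega
    have h1 := key _ ht _ ht' h
    have h2 := key _ ht' _ ht h.symm
    dsimp only at h h1 h2
    obtain rfl : b = b' := by omega
    have hk : κ (n - 1 - b) τ' = κ (n - 1 - b) τ := by omega
    simp only [mem_sigma, mem_range, mem_product, der132, mem_filter] at ht ht'
    rw [hk] at h
    have e1 := congrArg (blk (κ (n - 1 - b) τ) (κ (n - 1 - b) τ) b) h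
    have e2 := congrArg (cut (κ (n - 1 - b) τ) (κ (n - 1 - b) τ) (b + 1)) h
    rw [blk_ins (mem_av132.1 ht.2.1.1).1 (by omega),
      blk_ins (mem_av132.1 ht'.2.1.1).1 (by omega)] at e1
    rw [cut_ins, cut_ins] at e2
    rw [e1, e2]
  · intro f hf
    obtain ⟨hf, hfix⟩ := mem_filter.1 hf
    push Not at hfix
    have hi := Nat.find_spec hfix
    have hmin : ∀ x < Nat.find hfix, f x ≠ x := fun x hx e =>
      Nat.find_min hfix hx ⟨hx.trans hi.1, e⟩
    set i := Nat.find hfix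
    obtain ⟨k, b, hkb, hk, hB⟩ := exists_block_of_fixed hf hi.1 hi.2
    rw [← hkb] at hi hk hmin
    have hC := isCorner_cut hf hi.1 hi.2 hk hB
    have hB' : ∀ x, k ≤ x → x < k + b → k ≤ f x ∧ f x < k + b := fun x hx hx' => by
      have := (hB x).1 ⟨by omega, by omega⟩
      have : f x ≠ k + b := fun e => by
        have := inj_of_mem_perms (mem_av132.1 hf).1 (e.trans hi.2.symm)
        omega
      omega
    have hcut : cut k k (b + 1) f ∈ av132 (n - 1 - b) :=
      cut_mem_av132 hf (by omega) hC.1 hC.1 hB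
    have hκk := (hκ _ _ hcut).eq (mem_av132.1 hcut).1 hC
    refine ⟨⟨b, blk k k b f, cut k k (b + 1) f⟩, ?_, ?_⟩
    · simp only [mem_sigma, mem_range, mem_product, der132, mem_filter]
      refine ⟨by omega, ⟨blk_mem_av132 hf (by omega) hB', fun x hx => ?_⟩, hcut⟩
      have := hB' (k + x) (by omega) (by omega)
      have := hmin (k + x) (by omega)
      simp only [blk, hx, if_true]
      omega
    · dsimp only
      rw [hκk]
      refine ins_blk_cut hB fun x hx => ?_
      unfold blk
      split_ifs with h
      · have := hB' (k + x) (by omega) (by omega)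
        omega
      · obtain rfl : x = b := by omega
        exact hi.2

/-- The left-to-right minima of `f`, as points of its graph. -/
def lrMin (n : ℕ) (f : ℕ → ℕ) : Set (ℕ × ℕ) :=
  {q | q.1 < n ∧ f q.1 = q.2 ∧ ∀ x < q.1, q.2 < f x}

/-- A fixed left-to-right minimum is a block of length one. Deleting it is injective because it can
only return to the unique corner. -/
theorem card_av132_fixed_lrMin_le (n : ℕ) :
    ((av132 n).filter fun f => ∃ i, (i, i) ∈ lrMin n f).card ≤ (av132 (n - 1)).card := by
  have key : ∀ f i, f ∈ av132 n → (i, i) ∈ lrMin n f →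
      IsCorner (n - 1) (cut i i 1 f) i ∧ cut i i 1 f ∈ av132 (n - 1) ∧
        ins i i 1 id (cut i i 1 f) = f := by
    rintro f i hf ⟨hi, hfi, hlt⟩
    dsimp only at hi hfi hlt
    have hB : ∀ x, i ≤ x ∧ x < i + (0 + 1) ↔ i ≤ f x ∧ f x < i + (0 + 1) := by
      intro x
      constructor
      · intro hx
        obtain rfl : x = i := by omega
        omega
      · intro hx
        have := inj_of_mem_perms (mem_av132.1 hf).1 (x := x) (y := i) (by omega)
        omega
    have hC : IsCorner (n - 1) _ i := isCorner_cut (b := 0) hf hi hfi hlt hB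
    exact ⟨hC, cut_mem_av132 hf (by omega) hC.1 hC.1 hB,
      ins_blk_cut hB fun x hx => by
        obtain rfl : x = 0 := by omega
        simpa using hfi⟩
  have hex : ∀ f, (∃ i, (i, i) ∈ lrMin n f) → ∃ i, (i, i) ∈ lrMin n f := fun _ h => h
  choose! g hg using hex
  refine card_le_card_of_injOn (fun f => cut (g f) (g f) 1 f) (fun f hf => ?_)
    (fun f hf f' hf' h => ?_)
  · obtain ⟨h1, h2⟩ := mem_filter.1 hf
    exact (key f _ h1 (hg f h2)).2.1
  · obtain ⟨h1, h2⟩ := mem_filter.1 hf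
    obtain ⟨h1', h2'⟩ := mem_filter.1 hf'
    obtain ⟨k1, k2, k3⟩ := key f _ h1 (hg f h2)
    obtain ⟨k1', k2', k3'⟩ := key f' _ h1' (hg f' h2')
    dsimp only at h
    rw [← h] at k1' k3'
    rw [← k3, ← k3', k1.eq (mem_av132.1 k2).1 k1']

/-! ### Left-to-right minima determine avoiders of `123` and of `132` -/

theorem comp_swap_mem_perms {n j k : ℕ} {f : ℕ → ℕ} (hf : f ∈ perms n) (hj : j < n) (hk : k < n) :
    f ∘ Equiv.swap j k ∈ perms n := by
  refine mem_perms.2 ⟨fun x hx => ?_, fun x _ y _ h => ?_, fun x hx => ?_⟩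
  · apply lt_of_mem_perms hf
    rw [Equiv.swap_apply_def]
    split_ifs <;> assumption
  · exact (Equiv.swap j k).injective (inj_of_mem_perms hf h)
  · rw [Function.comp_apply, Equiv.swap_apply_of_ne_of_ne (by omega) (by omega),
      eq_of_mem_perms hf hx]

theorem lrMin_subset_comp_swap {n a j k : ℕ} {f : ℕ → ℕ} (haj : a < j) (hjk : j < k)
    (h1 : f a < f j) (h2 : f a < f k) : lrMin n f ⊆ lrMin n (f ∘ Equiv.swap j k) := by
  rintro ⟨x, v⟩ ⟨hx, e, hv⟩
  dsimp only at hx e hv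
  subst e
  have hxj : x ≠ j := by
    rintro rfl
    have := hv a haj
    omega
  have hxk : x ≠ k := by
    rintro rfl
    have := hv a (haj.trans hjk)
    omega
  refine ⟨hx, ?_, fun y hy => ?_⟩
  · simp [Equiv.swap_apply_of_ne_of_ne hxj hxk]
  · dsimp only at hy ⊢
    rw [Function.comp_apply, Equiv.swap_apply_def]
    split_ifs with h3 h4
    · subst h3
      exact (hv a (by omega)).trans h2
    · exact hv j (by omega)
    · exact hv y hy

/-- Neither swapped entry is ever a left-to-right minimum, as the smaller entry at `a` precedes
both. -/
theorem lrMin_comp_swap {n a j k : ℕ} {f : ℕ → ℕ} (haj : a < j) (hjk : j < k)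
    (h1 : f a < f j) (h2 : f a < f k) : lrMin n (f ∘ Equiv.swap j k) = lrMin n f := by
  refine (lrMin_subset_comp_swap haj hjk h1 h2).antisymm' ?_
  have h := lrMin_subset_comp_swap (n := n) (f := f ∘ Equiv.swap j k) haj hjk
  have ha : Equiv.swap j k a = a := Equiv.swap_apply_of_ne_of_ne (by omega) (by omega)
  simp only [Function.comp_apply, ha, Equiv.swap_apply_left, Equiv.swap_apply_right] at h
  have e : (f ∘ Equiv.swap j k) ∘ Equiv.swap j k = f := by
    funext x
    simp
  have := h h2 h1
  rwa [e] at this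

/-- This sum is the potential by which `123`s or `132`s are removed one swap at a time. -/
theorem sum_comp_swap_lt {n j k : ℕ} {f : ℕ → ℕ} (hjk : j < k) (hk : k < n) (h : f j < f k) :
    ∑ x ∈ range n, x * (f ∘ Equiv.swap j k) x < ∑ x ∈ range n, x * f x := by
  have hj' : j ∈ range n := mem_range.2 (hjk.trans hk)
  have hk' : k ∈ (range n).erase j := mem_erase.2 ⟨hjk.ne', mem_range.2 hk⟩
  rw [← add_sum_erase _ _ hj', ← add_sum_erase _ _ hk', ← add_sum_erase (range n) _ hj',
    ← add_sum_erase _ (fun x => x * f x) hk', ← add_assoc, ← add_assoc]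
  refine add_lt_add_of_lt_of_le ?_ (sum_le_sum fun x hx => ?_)
  · simp only [Function.comp_apply, Equiv.swap_apply_left, Equiv.swap_apply_right]
    nlinarith
  · simp only [mem_erase] at hx
    rw [Function.comp_apply, Equiv.swap_apply_of_ne_of_ne hx.2.1 hx.1]

/-- Among permutations with these left-to-right minima take one of least potential: swapping the
last two entries of a `123` would lower it. -/
theorem exists_av123_lrMin_eq {n : ℕ} {f : ℕ → ℕ} (hf : f ∈ perms n) :
    ∃ g ∈ av123 n, lrMin n g = lrMin n f := by
  obtain ⟨g, hg, hmin⟩ := exists_min_image ((perms n).filter fun g => lrMin n g = lrMin n f)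
    (fun g => ∑ x ∈ range n, x * g x) ⟨f, mem_filter.2 ⟨hf, rfl⟩⟩
  obtain ⟨hg, e⟩ := mem_filter.1 hg
  refine ⟨g, mem_av123.2 ⟨hg, fun a b c hab hbc hc h1 h2 => ?_⟩, e⟩
  have := hmin (g ∘ Equiv.swap b c) (mem_filter.2 ⟨comp_swap_mem_perms hg (by omega) hc,
    (lrMin_comp_swap hab hbc h1 (h1.trans h2)).trans e⟩)
  exact absurd this (not_le.2 (sum_comp_swap_lt hbc hc h2))

/-- Dually, swapping the last two entries of a `132` would raise the greatest potential. -/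
theorem exists_av132_lrMin_eq {n : ℕ} {f : ℕ → ℕ} (hf : f ∈ perms n) :
    ∃ g ∈ av132 n, lrMin n g = lrMin n f := by
  obtain ⟨g, hg, hmax⟩ := exists_max_image ((perms n).filter fun g => lrMin n g = lrMin n f)
    (fun g => ∑ x ∈ range n, x * g x) ⟨f, mem_filter.2 ⟨hf, rfl⟩⟩
  obtain ⟨hg, e⟩ := mem_filter.1 hg
  refine ⟨g, mem_av132.2 ⟨hg, fun a b c hab hbc hc h1 h2 => ?_⟩, e⟩
  have h3 := hmax (g ∘ Equiv.swap b c) (mem_filter.2 ⟨comp_swap_mem_perms hg (by omega) hc,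
    (lrMin_comp_swap hab hbc (h1.trans h2) h1).trans e⟩)
  have h4 := sum_comp_swap_lt (n := n) (f := g ∘ Equiv.swap b c) hbc hc (by simpa using h2)
  have e' : (g ∘ Equiv.swap b c) ∘ Equiv.swap b c = g := by
    funext x
    simp
  rw [e'] at h4
  omega

/-- If `f` and `g` have the same left-to-right minima and first differ at `p`, where `f p < g p`,
then the value `f p` completes a `132` in `g`, and the value `g p` completes a `123` in `f`. -/
theorem exists_of_lrMin_eq {n p : ℕ} {f g : ℕ → ℕ} (hf : f ∈ perms n) (hg : g ∈ perms n)
    (h : lrMin n f = lrMin n g) (hp : ∀ x < p, f x = g x) (hlt : f p < g p) :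
    ∃ q < p, (∃ r, p < r ∧ r < n ∧ g q < g r ∧ g r < g p) ∧
      ∃ r, p < r ∧ r < n ∧ f q < f p ∧ f p < f r := by
  have hpn : p < n := by
    by_contra hc
    rw [eq_of_mem_perms hf (by omega), eq_of_mem_perms hg (by omega)] at hlt
    exact lt_irrefl _ hlt
  obtain ⟨q, hqp, hq⟩ : ∃ q < p, f q < f p := by
    by_contra! hc
    have : (p, f p) ∈ lrMin n f := ⟨hpn, rfl, fun x hx => (hc x hx).lt_of_ne fun e => by
      have := inj_of_mem_perms hf e
      exact hx.ne' this⟩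
    rw [h] at this
    exact hlt.ne' this.2.1
  refine ⟨q, hqp, ?_, ?_⟩
  · obtain ⟨r, hr, e⟩ := exists_of_mem_perms hg (lt_of_mem_perms hf hpn)
    refine ⟨r, ?_, hr, by rw [← hp q hqp, e]; exact hq, by omega⟩
    by_contra! hc
    rcases hc.lt_or_eq with hc | rfl
    · rw [← hp r hc] at e
      exact hc.ne (inj_of_mem_perms hf e)
    · omega
  · obtain ⟨r, hr, e⟩ := exists_of_mem_perms hf (lt_of_mem_perms hg hpn)
    refine ⟨r, ?_, hr, hq, by omega⟩
    by_contra! hc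
    rcases hc.lt_or_eq with hc | rfl
    · rw [hp r hc] at e
      exact hc.ne (inj_of_mem_perms hg e)
    · omega

theorem exists_first_ne {f g : ℕ → ℕ} (h : f ≠ g) : ∃ p, (∀ x < p, f x = g x) ∧ f p ≠ g p := by
  have hex := Function.ne_iff.1 h
  exact ⟨Nat.find hex, fun x hx => not_not.1 (Nat.find_min hex hx), Nat.find_spec hex⟩

theorem lrMin_injOn_av123 (n : ℕ) : Set.InjOn (lrMin n) (av123 n : Set (ℕ → ℕ)) := by
  intro f hf g hg h
  rw [mem_coe, mem_av123] at hf hg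
  by_contra hne
  obtain ⟨p, hp, hne⟩ := exists_first_ne hne
  rcases hne.lt_or_gt with hlt | hlt
  · obtain ⟨q, hq, -, r, h1, h2, h3, h4⟩ := exists_of_lrMin_eq hf.1 hg.1 h hp hlt
    exact hf.2 q p r hq h1 h2 h3 h4
  · obtain ⟨q, hq, -, r, h1, h2, h3, h4⟩ :=
      exists_of_lrMin_eq hg.1 hf.1 h.symm (fun x hx => (hp x hx).symm) hlt
    exact hg.2 q p r hq h1 h2 h3 h4

theorem lrMin_injOn_av132 (n : ℕ) : Set.InjOn (lrMin n) (av132 n : Set (ℕ → ℕ)) := by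
  intro f hf g hg h
  rw [mem_coe, mem_av132] at hf hg
  by_contra hne
  obtain ⟨p, hp, hne⟩ := exists_first_ne hne
  rcases hne.lt_or_gt with hlt | hlt
  · obtain ⟨q, hq, ⟨r, h1, h2, h3, h4⟩, -⟩ := exists_of_lrMin_eq hf.1 hg.1 h hp hlt
    exact hg.2 q p r hq h1 h2 h3 h4
  · obtain ⟨q, hq, ⟨r, h1, h2, h3, h4⟩, -⟩ :=
      exists_of_lrMin_eq hg.1 hf.1 h.symm (fun x hx => (hp x hx).symm) hlt
    exact hf.2 q p r hq h1 h2 h3 h4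

/-- The left-to-right minima are equidistributed over avoiders of `123` and of `132`. -/
theorem card_filter_lrMin (n : ℕ) (P : Set (ℕ × ℕ) → Prop) :
    ((av123 n).filter fun f => P (lrMin n f)).card =
      ((av132 n).filter fun f => P (lrMin n f)).card := by
  rw [← card_image_of_injOn ((lrMin_injOn_av123 n).mono (coe_subset.2 (filter_subset _ _))),
    ← card_image_of_injOn ((lrMin_injOn_av132 n).mono (coe_subset.2 (filter_subset _ _)))]
  congr 1
  ext M
  simp only [mem_image, mem_filter]
  constructor
  · rintro ⟨f, ⟨hf, hP⟩, rfl⟩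
    obtain ⟨g, hg, e⟩ := exists_av132_lrMin_eq (mem_av123.1 hf).1
    exact ⟨g, ⟨hg, e ▸ hP⟩, e⟩
  · rintro ⟨f, ⟨hf, hP⟩, rfl⟩
    obtain ⟨g, hg, e⟩ := exists_av123_lrMin_eq (mem_av132.1 hf).1
    exact ⟨g, ⟨hg, e ▸ hP⟩, e⟩

theorem card_av123 (n : ℕ) : (av123 n).card = catalan n := by
  rw [← card_av132]
  simpa using card_filter_lrMin n fun _ => True

/-! ### Fixed points of `123`-avoiding permutations -/

/-- The `123`-avoiding permutations with a fixed point that is a left-to-right minimum. -/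
noncomputable def fixedMin (n : ℕ) : Finset (ℕ → ℕ) :=
  (av123 n).filter fun f => ∃ i, (i, i) ∈ lrMin n f

/-- The `123`-avoiding permutations with a fixed point that is a right-to-left maximum. -/
noncomputable def fixedMax (n : ℕ) : Finset (ℕ → ℕ) :=
  (av123 n).filter fun f => ∃ i < n, f i = i ∧ ∀ x, i < x → x < n → f x < i

theorem card_fixedMin_le (n : ℕ) : (fixedMin n).card ≤ catalan (n - 1) := by
  rw [fixedMin, card_filter_lrMin n fun M => ∃ i, (i, i) ∈ M, ← card_av132]
  exact card_av132_fixed_lrMin_le n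

/-- The reverse-complement of `f`. -/
def revCompl (n : ℕ) (f : ℕ → ℕ) (x : ℕ) : ℕ :=
  if x < n then n - 1 - f (n - 1 - x) else x

theorem revCompl_mem_av123 {n : ℕ} {f : ℕ → ℕ} (hf : f ∈ av123 n) : revCompl n f ∈ av123 n := by
  rw [mem_av123] at hf ⊢
  refine ⟨mem_perms.2 ⟨fun x hx => ?_, fun x hx y hy h => ?_, fun x hx => ?_⟩,
    fun a b c hab hbc hc h1 h2 => ?_⟩
  · simp only [revCompl, hx, if_true]
    omega
  · simp only [revCompl, hx, hy, if_true] at h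
    have h1 := lt_of_mem_perms hf.1 (x := n - 1 - x) (by omega)
    have h2 := lt_of_mem_perms hf.1 (x := n - 1 - y) (by omega)
    have := inj_of_mem_perms hf.1 (x := n - 1 - x) (y := n - 1 - y) (by omega)
    omega
  · simp only [revCompl, hx.not_gt, if_false]
  · have ha : a < n := by omega
    have hb : b < n := by omega
    simp only [revCompl, ha, hb, hc, if_true] at h1 h2
    exact hf.2 (n - 1 - c) (n - 1 - b) (n - 1 - a) (by omega) (by omega) (by omega)
      (by omega) (by omega)

/-- Reverse-complement preserves `123`-avoidance and exchanges fixed left-to-right minima with fixed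
right-to-left maxima. -/
theorem card_fixedMax_le (n : ℕ) : (fixedMax n).card ≤ catalan (n - 1) := by
  refine le_trans (card_le_card_of_injOn (revCompl n) (fun f hf => ?_) (fun f hf g hg h => ?_))
    (card_fixedMin_le n)
  · obtain ⟨hf, i, hi, hfi, h⟩ := mem_filter.1 hf
    refine mem_filter.2 ⟨revCompl_mem_av123 hf, n - 1 - i, ?_, ?_, fun x hx => ?_⟩
    · dsimp only
      omega
    · have h1 : n - 1 - i < n := by omega
      have h2 : n - 1 - (n - 1 - i) = i := by omega
      simp only [revCompl, h1, h2, hfi, if_true]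
    · dsimp only at hx ⊢
      have h1 : x < n := by omega
      have := h (n - 1 - x) (by omega) (by omega)
      simp only [revCompl, h1, if_true]
      omega
  · have hf := (mem_av123.1 (mem_filter.1 hf).1).1
    have hg := (mem_av123.1 (mem_filter.1 hg).1).1
    funext x
    rcases lt_or_ge x n with hx | hx
    · have e := congrFun h (n - 1 - x)
      have h1 : n - 1 - x < n := by omega
      have h2 : n - 1 - (n - 1 - x) = x := by omega
      simp only [revCompl, h1, h2, if_true] at e
      have := lt_of_mem_perms hf hx
      have := lt_of_mem_perms hg hx
      omega
    · rw [eq_of_mem_perms hf hx, eq_of_mem_perms hg hx]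

theorem catalan_add_le (n : ℕ) :
    catalan n + (fixedMin n ∩ fixedMax n).card ≤ (der123 n).card + 2 * catalan (n - 1) := by
  have h1 : av123 n ⊆ der123 n ∪ (fixedMin n ∪ fixedMax n) := by
    intro f hf
    by_cases hd : ∀ x < n, f x ≠ x
    · exact mem_union_left _ (mem_filter.2 ⟨hf, hd⟩)
    push Not at hd
    obtain ⟨i, hi, hfi⟩ := hd
    have hinj : ∀ x, f x = i → x = i := fun x e =>
      inj_of_mem_perms (mem_av123.1 hf).1 (e.trans hfi.symm)
    apply mem_union_right
    by_cases hl : ∀ x < i, i < f x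
    · exact mem_union_left _ (mem_filter.2 ⟨hf, i, hi, hfi, hl⟩)
    push Not at hl
    obtain ⟨a, ha, hfa⟩ := hl
    refine mem_union_right _ (mem_filter.2 ⟨hf, i, hi, hfi, fun x hx hxn => ?_⟩)
    by_contra hc
    have := hinj a
    have := hinj x
    exact (mem_av123.1 hf).2 a i x ha hx hxn (by omega) (by omega)
  have h2 := card_le_card h1
  have h3 := card_union_le (der123 n) (fixedMin n ∪ fixedMax n)
  have h4 := card_union_add_card_inter (fixedMin n) (fixedMax n)
  have h5 := card_fixedMin_le n
  have h6 := card_fixedMax_le n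
  rw [card_av123] at h2
  omega

/-! ### `123`-avoiding permutations with fixed points of both kinds -/

/-- The skew sum of `τ`, the identity of length `d`, and `ρ`, where `τ` and `ρ` have length `r`. -/
def skew (d r : ℕ) (τ ρ : ℕ → ℕ) (x : ℕ) : ℕ :=
  if x < r then r + d + τ x else if x < r + d then x
  else if x < 2 * r + d then ρ (x - (r + d)) else x

theorem skew_left {d r : ℕ} {τ ρ : ℕ → ℕ} {x : ℕ} (h : x < r) :
    skew d r τ ρ x = r + d + τ x := by
  simp [skew, h]

theorem skew_mid {d r : ℕ} {τ ρ : ℕ → ℕ} {x : ℕ} (h : r ≤ x) (h' : x < r + d) :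
    skew d r τ ρ x = x := by
  simp [skew, h.not_gt, h']

theorem skew_right {d r : ℕ} {τ ρ : ℕ → ℕ} {x : ℕ} (h : x < r) :
    skew d r τ ρ (r + d + x) = ρ x := by
  have h1 : ¬ r + d + x < r := by omega
  have h2 : r + d + x < 2 * r + d := by omega
  simp [skew, h1, h2]

theorem cases_skew {d r x : ℕ} (hx : x < 2 * r + d) :
    x < r ∨ (r ≤ x ∧ x < r + d) ∨ ∃ y < r, x = r + d + y := by
  rcases lt_or_ge x r with h | h
  · exact Or.inl h
  rcases lt_or_ge x (r + d) with h' | h'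
  · exact Or.inr (Or.inl ⟨h, h'⟩)
  · exact Or.inr (Or.inr ⟨x - (r + d), by omega, by omega⟩)

/-- Later blocks hold smaller values, so an increasing triple stays within one block, and the middle
block has at most two entries. -/
theorem skew_mem_av123 {d r : ℕ} (hd : d ≤ 2) {τ ρ : ℕ → ℕ} (hτ : τ ∈ av123 r)
    (hρ : ρ ∈ av123 r) : skew d r τ ρ ∈ av123 (2 * r + d) := by
  rw [mem_av123] at *
  refine ⟨mem_perms.2 ⟨fun x hx => ?_, fun x hx y hy h => ?_, fun x hx => ?_⟩,
    fun x y z hxy hyz hz h1 h2 => ?_⟩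
  · rcases cases_skew hx with h | ⟨h, h'⟩ | ⟨y, h, rfl⟩
    · rw [skew_left h]
      have := lt_of_mem_perms hτ.1 h
      omega
    · rw [skew_mid h h']
      omega
    · rw [skew_right h]
      have := lt_of_mem_perms hρ.1 h
      omega
  · rcases cases_skew hx with h1 | ⟨h1, h1'⟩ | ⟨x, h1, rfl⟩ <;>
      rcases cases_skew hy with h2 | ⟨h2, h2'⟩ | ⟨y, h2, rfl⟩
    · rw [skew_left h1, skew_left h2] at h
      exact inj_of_mem_perms hτ.1 (by omega)
    · rw [skew_left h1, skew_mid h2 h2'] at h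
      omega
    · rw [skew_left h1, skew_right h2] at h
      have := lt_of_mem_perms hρ.1 h2
      omega
    · rw [skew_left h2, skew_mid h1 h1'] at h
      omega
    · rwa [skew_mid h1 h1', skew_mid h2 h2'] at h
    · rw [skew_mid h1 h1', skew_right h2] at h
      have := lt_of_mem_perms hρ.1 h2
      omega
    · rw [skew_left h2, skew_right h1] at h
      have := lt_of_mem_perms hρ.1 h1
      omega
    · rw [skew_mid h2 h2', skew_right h1] at h
      have := lt_of_mem_perms hρ.1 h1
      omega
    · rw [skew_right h1, skew_right h2] at h
      rw [inj_of_mem_perms hρ.1 h]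
  · have h1 : ¬ x < r := by omega
    have h2 : ¬ x < r + d := by omega
    have h3 : ¬ x < 2 * r + d := by omega
    simp [skew, h1, h2, h3]
  · rcases cases_skew hz with h | ⟨h, h'⟩ | ⟨z, h, rfl⟩
    · rw [skew_left (by omega : y < r)] at h1 h2
      rw [skew_left (by omega : x < r)] at h1
      rw [skew_left h] at h2
      exact hτ.2 x y z hxy hyz h (by omega) (by omega)
    · rw [skew_mid h h'] at h2
      rcases cases_skew (hyz.trans hz) with g | ⟨g, g'⟩ | ⟨y, g, rfl⟩
      · rw [skew_left g] at h2
        omega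
      · rw [skew_mid g g'] at h1 h2
        have : x < r := by omega
        rw [skew_left this] at h1
        omega
      · omega
    · rw [skew_right h] at h2
      have := lt_of_mem_perms hρ.1 h
      rcases cases_skew (hyz.trans hz) with g | ⟨g, g'⟩ | ⟨y, g, rfl⟩
      · rw [skew_left g] at h2
        omega
      · rw [skew_mid g g'] at h2
        omega
      · rw [skew_right g] at h1 h2
        have := lt_of_mem_perms hρ.1 g
        rcases cases_skew (hxy.trans (hyz.trans hz)) with k | ⟨k, k'⟩ | ⟨x, k, rfl⟩
        · rw [skew_left k] at h1
          omega
        · rw [skew_mid k k'] at h1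
          omega
        · rw [skew_right k] at h1
          exact hρ.2 x y z (by omega) (by omega) h h1 h2

/-- All the skew sums of two `123`-avoiders of length `r` around the identity of length `d`. -/
noncomputable def skews (d r : ℕ) : Finset (ℕ → ℕ) :=
  (av123 r ×ˢ av123 r).image fun t => skew d r t.1 t.2

theorem card_skews (d r : ℕ) : (skews d r).card = catalan r * catalan r := by
  rw [skews, card_image_of_injOn, card_product, card_av123]
  rintro ⟨τ, ρ⟩ h ⟨τ', ρ'⟩ h' e
  simp only [coe_product, Set.mem_prod, mem_coe, mem_av123] at h h'
  dsimp only at e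
  have e1 : τ = τ' := by
    funext x
    rcases lt_or_ge x r with hx | hx
    · have := congrFun e x
      rw [skew_left hx, skew_left hx] at this
      omega
    · rw [eq_of_mem_perms h.1.1 hx, eq_of_mem_perms h'.1.1 hx]
  have e2 : ρ = ρ' := by
    funext x
    rcases lt_or_ge x r with hx | hx
    · have := congrFun e (r + d + x)
      rwa [skew_right hx, skew_right hx] at this
    · rw [eq_of_mem_perms h.2.1 hx, eq_of_mem_perms h'.2.1 hx]
  rw [e1, e2]

theorem of_mem_skews {d r : ℕ} (hd : d ≤ 2) {f : ℕ → ℕ} (hf : f ∈ skews d r) :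
    f ∈ av123 (2 * r + d) ∧ (∀ x < r, r + d ≤ f x ∧ f x < 2 * r + d) ∧
      (∀ x, r ≤ x → x < r + d → f x = x) ∧ ∀ x, r + d ≤ x → x < 2 * r + d → f x < r := by
  obtain ⟨⟨τ, ρ⟩, h, rfl⟩ := mem_image.1 hf
  obtain ⟨hτ, hρ⟩ := mem_product.1 h
  refine ⟨skew_mem_av123 hd hτ hρ, fun x hx => ?_, fun x hx hx' => skew_mid hx hx',
    fun x hx hx' => ?_⟩
  · have := lt_of_mem_perms (mem_av123.1 hτ).1 hx
    dsimp only at this ⊢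
    rw [skew_left hx]
    omega
  · obtain ⟨x, rfl⟩ := Nat.exists_eq_add_of_le hx
    simp only [skew_right (by omega : x < r)]
    exact lt_of_mem_perms (mem_av123.1 hρ).1 (by omega)

/-- The two witnesses are the ends `r` and `r + d - 1` of the middle block, which coincide when `d =
1`. -/
theorem skews_subset {d r : ℕ} (hd : d ≤ 2) (hd' : 0 < d) :
    skews d r ⊆ fixedMin (2 * r + d) ∩ fixedMax (2 * r + d) := by
  intro f hf
  obtain ⟨h, hl, hm, hr⟩ := of_mem_skews hd hf
  refine mem_inter.2 ⟨mem_filter.2 ⟨h, r, ?_, hm r le_rfl (by omega), fun x hx => ?_⟩,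
    mem_filter.2 ⟨h, r + d - 1, by omega, hm _ (by omega) (by omega), fun x hx hx' => ?_⟩⟩
  · dsimp only
    omega
  · have := hl x hx
    dsimp only
    omega
  · have := hr x (by omega) hx'
    omega

theorem card_inter_odd (r : ℕ) : catalan r * catalan r ≤
    (fixedMin (2 * r + 1) ∩ fixedMax (2 * r + 1)).card := by
  rw [← card_skews 1 r]
  exact card_le_card (skews_subset (by omega) (by omega))

/-- The skew sums give only `4` here, one short of what `n = 5` needs. The extra permutation is `2 1
4 3 0`, with fixed points `1` and `3`. -/
theorem card_inter_five : 5 ≤ (fixedMin 5 ∩ fixedMax 5).card := by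
  let e : ℕ → ℕ := fun x => if x = 0 then 2 else if x = 2 then 4 else if x = 4 then 0 else x
  have he : e ∈ fixedMin 5 ∩ fixedMax 5 := by
    have h : e ∈ av123 5 := by
      refine mem_av123.2 ⟨mem_perms.2 ⟨fun x hx => ?_, fun x hx y hy h => ?_, fun x hx => ?_⟩,
        fun a b c hab hbc hc h1 h2 => ?_⟩
      · simp only [e]
        split_ifs <;> omega
      · simp only [e] at h
        split_ifs at h <;> omega
      · simp only [e]
        split_ifs <;> omega
      · simp only [e] at h1 h2
        split_ifs at h1 h2 <;> omega
    refine mem_inter.2 ⟨mem_filter.2 ⟨h, 1, by simp, by simp [e], fun x hx => ?_⟩,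
      mem_filter.2 ⟨h, 3, by simp, by simp [e], fun x hx hx' => ?_⟩⟩
    · dsimp only at hx
      obtain rfl : x = 0 := by omega
      simp [e]
    · obtain rfl : x = 4 := by omega
      simp [e]
  have hn : e ∉ skews 1 2 := fun h => by
    have := (of_mem_skews (by omega) h).2.2.1 2 le_rfl (by omega)
    simp [e] at this
  have h1 := card_le_card (insert_subset he (skews_subset (d := 1) (r := 2) (by omega) (by omega)))
  rw [card_insert_of_notMem hn, card_skews, catalan_two] at h1
  exact h1

/-- Conjugation by the transposition of `j` and `j + 1`. -/
def conjSwap (j : ℕ) (f : ℕ → ℕ) : ℕ → ℕ :=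
  Equiv.swap j (j + 1) ∘ f ∘ Equiv.swap j (j + 1)

theorem conjSwap_injective (j : ℕ) : Function.Injective (conjSwap j) := by
  intro f g h
  funext x
  have := congrFun h (Equiv.swap j (j + 1) x)
  simpa [conjSwap] using this

theorem conjSwap_mem_perms {n j : ℕ} {f : ℕ → ℕ} (hf : f ∈ perms n) (hj : j + 1 < n) :
    conjSwap j f ∈ perms n := by
  have h := comp_swap_mem_perms hf (j := j) (by omega) hj
  refine mem_perms.2 ⟨fun x hx => ?_, fun x _ y _ e => ?_, fun x hx => ?_⟩
  · have := lt_of_mem_perms h hx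
    simp only [conjSwap, Function.comp_apply, Equiv.swap_apply_def j (j + 1) (f _)] at this ⊢
    split_ifs <;> omega
  · exact inj_of_mem_perms h ((Equiv.swap j (j + 1)).injective e)
  · have := eq_of_mem_perms h hx
    simp only [conjSwap, Function.comp_apply] at this ⊢
    rw [this, Equiv.swap_apply_of_ne_of_ne (by omega) (by omega)]

theorem conjSwap_left_spec {r : ℕ} {f : ℕ → ℕ} (hf : f ∈ skews 2 (r + 1)) :
    let g := conjSwap r f
    (∀ x < r, g x = f x) ∧ g r = r ∧ g (r + 1) = f r ∧ g (r + 2) = r + 2 ∧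
      ∀ x, r + 3 ≤ x → x < 2 * r + 4 → g x = if f x = r then r + 1 else f x := by
  obtain ⟨-, hl, hm, hr⟩ := of_mem_skews le_rfl hf
  have h1 := hm (r + 1) le_rfl (by omega)
  have h2 := hm (r + 2) (by omega) (by omega)
  have hs : ∀ x, x ≠ r → x ≠ r + 1 → Equiv.swap r (r + 1) x = x := fun x a b =>
    Equiv.swap_apply_of_ne_of_ne a b
  refine ⟨fun x hx => ?_, ?_, ?_, ?_, fun x hx hx' => ?_⟩
  · have := hl x (by omega)
    simp only [conjSwap, Function.comp_apply]
    rw [hs x (by omega) (by omega), hs _ (by omega) (by omega)]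
  · simp [conjSwap, h1]
  · have := hl r (by omega)
    simp only [conjSwap, Function.comp_apply, Equiv.swap_apply_right]
    rw [hs _ (by omega) (by omega)]
  · simp only [conjSwap, Function.comp_apply]
    rw [hs (r + 2) (by omega) (by omega), h2, hs _ (by omega) (by omega)]
  · have := hr x (by omega) (by omega)
    simp only [conjSwap, Function.comp_apply]
    rw [hs x (by omega) (by omega), Equiv.swap_apply_def]
    split_ifs <;> omega

theorem conjSwap_right_spec {r : ℕ} {f : ℕ → ℕ} (hf : f ∈ skews 2 (r + 1)) :
    let g := conjSwap (r + 2) f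
    (∀ x < r + 1, g x = if f x = r + 3 then r + 2 else f x) ∧ g (r + 1) = r + 1 ∧
      g (r + 2) = f (r + 3) ∧ g (r + 3) = r + 3 ∧
      ∀ x, r + 4 ≤ x → x < 2 * r + 4 → g x = f x := by
  obtain ⟨-, hl, hm, hr⟩ := of_mem_skews le_rfl hf
  have h1 := hm (r + 1) le_rfl (by omega)
  have h2 := hm (r + 2) (by omega) (by omega)
  have hs : ∀ x, x ≠ r + 2 → x ≠ r + 2 + 1 → Equiv.swap (r + 2) (r + 2 + 1) x = x := fun x a b =>
    Equiv.swap_apply_of_ne_of_ne a b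
  refine ⟨fun x hx => ?_, ?_, ?_, ?_, fun x hx hx' => ?_⟩
  · have := hl x (by omega)
    simp only [conjSwap, Function.comp_apply]
    rw [hs x (by omega) (by omega), Equiv.swap_apply_def]
    split_ifs <;> omega
  · simp only [conjSwap, Function.comp_apply]
    rw [hs (r + 1) (by omega) (by omega), h1, hs _ (by omega) (by omega)]
  · have := hr (r + 3) (by omega) (by omega)
    simp only [conjSwap, Function.comp_apply, Equiv.swap_apply_left]
    exact hs (f (r + 3)) (by omega) (by omega)
  · simp only [conjSwap, Function.comp_apply]
    rw [show r + 3 = r + 2 + 1 from rfl, Equiv.swap_apply_right, h2, Equiv.swap_apply_left]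
  · have := hr x (by omega) (by omega)
    simp only [conjSwap, Function.comp_apply]
    rw [hs x (by omega) (by omega), hs _ (by omega) (by omega)]

/-- The conjugation moves the fixed point `r + 1` to `r`. A `123` in the result would come from one
inside the first or last block of `f`: position `r + 1` plays the role of `r` in the first, and
value `r + 1` that of `r` in the last. -/
theorem conjSwap_left_mem {r : ℕ} {f : ℕ → ℕ} (hf : f ∈ skews 2 (r + 1)) :
    conjSwap r f ∈ fixedMin (2 * r + 4) ∩ fixedMax (2 * r + 4) := by
  obtain ⟨h, hl, hm, hr⟩ := of_mem_skews le_rfl hf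
  have hg := conjSwap_mem_perms (n := 2 * r + 4) (j := r) (mem_av123.1 h).1 (by omega)
  obtain ⟨g1, g2, g3, g4, g5⟩ := conjSwap_left_spec hf
  generalize conjSwap r f = g at *
  have hfr := hl r (by omega)
  have hav : g ∈ av123 (2 * r + 4) := by
    refine mem_av123.2 ⟨hg, fun a b c hab hbc hc h1 h2 => ?_⟩
    have big : ∀ x, r + 2 ≤ x → x < 2 * r + 4 → g x ≤ r + 2 ∧ (r + 2 < x → g x ≤ r + 1) := by
      intro x hx hx'
      rcases hx.lt_or_eq with hx | rfl
      · have := g5 x (by omega) hx'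
        have := hr x (by omega) (by omega)
        split_ifs at * <;> omega
      · omega
    rcases lt_or_ge (r + 2) a with ha | ha
    · have ea := g5 a (by omega) (by omega)
      have eb := g5 b (by omega) (by omega)
      have ec := g5 c (by omega) (by omega)
      have := hr a (by omega) (by omega)
      have := hr b (by omega) (by omega)
      have := hr c (by omega) (by omega)
      refine (mem_av123.1 h).2 a b c hab hbc (by omega) ?_ ?_ <;>
        split_ifs at * <;> omega
    rcases lt_or_ge a r with ha' | ha'
    · have e := g1 a ha'
      have := hl a (by omega)
      have hb : b ≤ r + 1 := by
        by_contra hc'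
        have := big b (by omega) (by omega)
        omega
      have hc' : c ≤ r + 1 := by
        by_contra hc'
        have := big c (by omega) (by omega)
        omega
      have hbr : b ≠ r := by
        rintro rfl
        omega
      have hcr : c ≠ r := by
        rintro rfl
        omega
      have eb := g1 b (by omega)
      rcases hc'.lt_or_eq with hc' | rfl
      · have ec := g1 c (by omega)
        exact (mem_av123.1 h).2 a b c hab hbc (by omega) (by omega) (by omega)
      · exact (mem_av123.1 h).2 a b r hab (by omega) (by omega) (by omega) (by omega)
    · obtain rfl | rfl | rfl : a = r ∨ a = r + 1 ∨ a = r + 2 := by omega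
      · have := big c (by omega) hc
        obtain rfl | hb : b = a + 1 ∨ a + 2 ≤ b := by omega
        · omega
        · have := big b hb (by omega)
          omega
      · have := big b (by omega) (by omega)
        omega
      · have := big b (by omega) (by omega)
        omega
  refine mem_inter.2 ⟨mem_filter.2 ⟨hav, r, ?_, g2, fun x hx => ?_⟩,
    mem_filter.2 ⟨hav, r + 2, by omega, g4, fun x hx hx' => ?_⟩⟩
  · dsimp only
    omega
  · have := g1 x hx
    have := hl x (by dsimp only at hx; omega)
    dsimp only
    omega
  · have := g5 x (by omega) hx'
    have := hr x (by omega) (by omega)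
    split_ifs at * <;> omega

theorem conjSwap_right_mem {r : ℕ} {f : ℕ → ℕ} (hf : f ∈ skews 2 (r + 1)) :
    conjSwap (r + 2) f ∈ fixedMin (2 * r + 4) ∩ fixedMax (2 * r + 4) := by
  obtain ⟨h, hl, hm, hr⟩ := of_mem_skews le_rfl hf
  have hg := conjSwap_mem_perms (n := 2 * r + 4) (j := r + 2) (mem_av123.1 h).1 (by omega)
  obtain ⟨g1, g2, g3, g4, g5⟩ := conjSwap_right_spec hf
  generalize conjSwap (r + 2) f = g at *
  have hfr := hr (r + 3) (by omega) (by omega)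
  have hav : g ∈ av123 (2 * r + 4) := by
    refine mem_av123.2 ⟨hg, fun a b c hab hbc hc h1 h2 => ?_⟩
    have small : ∀ x, x ≤ r + 1 → r + 1 ≤ g x ∧ (x < r + 1 → r + 2 ≤ g x) := by
      intro x hx
      rcases hx.lt_or_eq with hx | rfl
      · have := g1 x (by omega)
        have := hl x (by omega)
        split_ifs at * <;> omega
      · omega
    rcases lt_or_ge c (r + 1) with hc' | hc'
    · have ea := g1 a (by omega)
      have eb := g1 b (by omega)
      have ec := g1 c (by omega)
      have := hl a (by omega)
      have := hl b (by omega)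
      have := hl c (by omega)
      refine (mem_av123.1 h).2 a b c hab hbc (by omega) ?_ ?_ <;>
        split_ifs at * <;> omega
    rcases lt_or_ge (r + 3) c with hc'' | hc''
    · have e := g5 c (by omega) hc
      have := hr c (by omega) (by omega)
      have hb : r + 2 ≤ b := by
        by_contra hb
        have := small b (by omega)
        omega
      have ha : r + 2 ≤ a := by
        by_contra ha
        have := small a (by omega)
        omega
      have hbr : b ≠ r + 3 := by
        rintro rfl
        omega
      have har : a ≠ r + 3 := by
        rintro rfl
        omega
      have eb := g5 b (by omega) (by omega)
      obtain rfl | ha : a = r + 2 ∨ r + 4 ≤ a := by omega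
      · exact (mem_av123.1 h).2 (r + 3) b c (by omega) hbc (by omega) (by omega) (by omega)
      · have ea := g5 a ha (by omega)
        exact (mem_av123.1 h).2 a b c hab hbc (by omega) (by omega) (by omega)
    · obtain rfl | rfl | rfl : c = r + 1 ∨ c = r + 2 ∨ c = r + 3 := by omega
      · have := small b (by omega)
        omega
      · have := small b (by omega)
        omega
      · have := small a (by omega)
        obtain rfl | hb : b = r + 2 ∨ b ≤ r + 1 := by omega
        · omega
        · have := small b hb
          omega
  refine mem_inter.2 ⟨mem_filter.2 ⟨hav, r + 1, ?_, g2, fun x hx => ?_⟩,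
    mem_filter.2 ⟨hav, r + 3, by omega, g4, fun x hx hx' => ?_⟩⟩
  · dsimp only
    omega
  · have := g1 x hx
    have := hl x hx
    dsimp only
    split_ifs at * <;> omega
  · have := g5 x (by omega) hx'
    have := hr x (by omega) (by omega)
    omega

/-- The skew sums and their two conjugates are told apart by their fixed points: `r + 1, r + 2` for
the first family, `r, r + 2` and `r + 1, r + 3` for the others. -/
theorem card_inter_even (r : ℕ) : 3 * (catalan (r + 1) * catalan (r + 1)) ≤
    (fixedMin (2 * r + 4) ∩ fixedMax (2 * r + 4)).card := by
  have h1 : Disjoint (skews 2 (r + 1)) ((skews 2 (r + 1)).image (conjSwap r)) := by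
    rw [disjoint_left]
    intro f hf hf'
    obtain ⟨g, hg, rfl⟩ := mem_image.1 hf'
    have := (of_mem_skews le_rfl hf).2.1 r (by omega)
    have := (conjSwap_left_spec hg).2.1
    omega
  have h2 : Disjoint (skews 2 (r + 1) ∪ (skews 2 (r + 1)).image (conjSwap r))
      ((skews 2 (r + 1)).image (conjSwap (r + 2))) := by
    rw [disjoint_left]
    intro f hf hf'
    obtain ⟨g, hg, rfl⟩ := mem_image.1 hf'
    obtain ⟨-, h3, h4, -⟩ := conjSwap_right_spec hg
    have h5 := (of_mem_skews le_rfl hg).2.2.2 (r + 3) (by omega) (by omega)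
    rcases mem_union.1 hf with hf | hf
    · have := (of_mem_skews le_rfl hf).2.2.1 (r + 2) (by omega) (by omega)
      omega
    · obtain ⟨g', hg', e⟩ := mem_image.1 hf
      have := (conjSwap_left_spec hg').2.2.2.1
      rw [e] at this
      omega
  calc 3 * (catalan (r + 1) * catalan (r + 1))
      = ((skews 2 (r + 1) ∪ (skews 2 (r + 1)).image (conjSwap r)) ∪
          (skews 2 (r + 1)).image (conjSwap (r + 2))).card := by
        rw [card_union_of_disjoint h2, card_union_of_disjoint h1,
          card_image_of_injective _ (conjSwap_injective _),
          card_image_of_injective _ (conjSwap_injective _), card_skews]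
        ring
    _ ≤ _ := by
        apply card_le_card
        refine union_subset (union_subset (skews_subset le_rfl (by omega)) ?_) ?_
        · intro f hf
          obtain ⟨g, hg, rfl⟩ := mem_image.1 hf
          exact conjSwap_left_mem hg
        · intro f hf
          obtain ⟨g, hg, rfl⟩ := mem_image.1 hf
          exact conjSwap_right_mem hg

/-! ### Numerical comparison -/

theorem catalan_succ_eq (n : ℕ) :
    catalan (n + 1) = 2 * (der132 (n + 1)).card + (der132 n).card := by
  let C : PowerSeries ℤ := PowerSeries.mk fun n => (catalan n : ℤ)
  let F : PowerSeries ℤ := PowerSeries.mk fun n => ((der132 n).card : ℤ)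
  have hC : C = 1 + PowerSeries.X * (C * C) := by
    ext n
    cases n with
    | zero => simp [C]
    | succ n =>
      rw [map_add, PowerSeries.coeff_succ_X_mul, PowerSeries.coeff_mul]
      simp [C, PowerSeries.coeff_one, catalan_succ']
  have hF : C = F + PowerSeries.X * (F * C) := by
    ext n
    cases n with
    | zero =>
      have := card_av132_eq_add 0
      rw [card_av132] at this
      simp at this
      simp [C, F, ← this]
    | succ n =>
      have := card_av132_eq_add (n + 1)
      simp only [card_av132, Nat.add_sub_cancel] at this
      rw [map_add, PowerSeries.coeff_succ_X_mul, PowerSeries.coeff_mul,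
        Nat.sum_antidiagonal_eq_sum_range_succ_mk]
      simp only [C, F, PowerSeries.coeff_mk]
      exact_mod_cast this
  have h : (2 + PowerSeries.X) * F = 1 + C := by
    -- Since `C = F (1 + X C)` and `(1 + C)(1 + X C) = (2 + X) C`, the claim holds after multiplying
    -- by `1 + X C`.
    have hne : (1 + PowerSeries.X * C : PowerSeries ℤ) ≠ 0 := fun h => by
      simpa using congrArg PowerSeries.constantCoeff h
    apply mul_right_cancel₀ hne
    linear_combination (-(2 + PowerSeries.X)) * hF + hC
  have := congrArg (PowerSeries.coeff (n + 1)) h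
  rw [add_mul, two_mul, map_add, map_add, map_add, PowerSeries.coeff_succ_X_mul] at this
  simp only [C, F, PowerSeries.coeff_mk, PowerSeries.coeff_one, Nat.add_one_ne_zero,
    if_false] at this
  omega

theorem succ_succ_mul_catalan_succ (n : ℕ) :
    (n + 2) * catalan (n + 1) = 2 * (2 * n + 1) * catalan n := by
  have h1 := succ_mul_catalan_eq_centralBinom (n + 1)
  have h2 := succ_mul_catalan_eq_centralBinom n
  have h3 := Nat.succ_mul_centralBinom_succ n
  rw [← h1, ← h2] at h3
  apply Nat.eq_of_mul_eq_mul_left (Nat.succ_pos n)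
  linarith

/-- Three uses of the recurrence give `8 F n ≤ 4 C n - 2 C (n-1) + C (n-2)`, which reduces the claim
to `key`. The threshold is sharp: at `n = 12` the left side is `208716` and the right side `208012`.
-/
theorem der132_lt_of_le {n : ℕ} (hn : 13 ≤ n) :
    (der132 n).card + 2 * catalan (n - 1) < catalan n := by
  obtain ⟨m, rfl⟩ : ∃ m, n = m + 3 := ⟨n - 3, by omega⟩
  have h1 := catalan_succ_eq (m + 2)
  have h2 := catalan_succ_eq (m + 1)
  have h3 := catalan_succ_eq m
  have h4 := succ_succ_mul_catalan_succ (m + 2)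
  have h5 := succ_succ_mul_catalan_succ (m + 1)
  have h6 : 0 < catalan (m + 1) := by
    have := Nat.centralBinom_pos (m + 1)
    rw [← succ_mul_catalan_eq_centralBinom] at this
    exact Nat.pos_of_mul_pos_left this
  simp only [add_assoc, Nat.reduceAdd] at h1 h2 h3 h4 h5
  rw [show m + 3 - 1 = m + 2 by omega]
  have key : 14 * catalan (m + 2) + catalan (m + 1) < 4 * catalan (m + 3) := by
    have h7 : (m + 3) * (m + 4) * (14 * catalan (m + 2) + catalan (m + 1)) <
        (m + 3) * (m + 4) * (4 * catalan (m + 3)) := by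
      calc (m + 3) * (m + 4) * (14 * catalan (m + 2) + catalan (m + 1))
          = (14 * (m + 4) * (2 * (2 * (m + 1) + 1)) + (m + 3) * (m + 4)) * catalan (m + 1) := by
            linear_combination 14 * (m + 4) * h5
        _ < (4 * (2 * (2 * (m + 2) + 1)) * (2 * (2 * (m + 1) + 1))) * catalan (m + 1) := by
            apply Nat.mul_lt_mul_of_pos_right _ h6
            -- The difference of the two coefficients is `7 m² - 59 m - 108`, which is `2` at `m =
            -- 10` and negative at `m = 9`.
            obtain ⟨l, rfl⟩ := Nat.exists_eq_add_of_le (show 10 ≤ m by omega)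
            ring_nf
            nlinarith [Nat.zero_le l]
        _ = _ := by
            zify at h4 h5 ⊢
            linear_combination (-4 * (2 * (2 * (m + 2) + 1))) * h5 - 4 * (m + 3) * h4
    exact lt_of_mul_lt_mul_left h7 (Nat.zero_le _)
  omega

theorem card_der132_lt_card_der123 {n : ℕ} (hn : 4 ≤ n) : (der132 n).card < (der123 n).card := by
  have main := catalan_add_le n
  rcases le_or_gt 13 n with h | h
  · have := der132_lt_of_le h
    omega
  have c2 := catalan_two
  have c3 := catalan_three
  have c4 := succ_succ_mul_catalan_succ 3
  have c5 := succ_succ_mul_catalan_succ 4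
  have c6 := succ_succ_mul_catalan_succ 5
  have c7 := succ_succ_mul_catalan_succ 6
  have c8 := succ_succ_mul_catalan_succ 7
  have c9 := succ_succ_mul_catalan_succ 8
  have c10 := succ_succ_mul_catalan_succ 9
  have c11 := succ_succ_mul_catalan_succ 10
  have c12 := succ_succ_mul_catalan_succ 11
  norm_num at c4
  have d0 := catalan_succ_eq 0
  have d1 := catalan_succ_eq 1
  have d2 := catalan_succ_eq 2
  have d3 := catalan_succ_eq 3
  have d4 := catalan_succ_eq 4
  have d5 := catalan_succ_eq 5
  have d6 := catalan_succ_eq 6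
  have d7 := catalan_succ_eq 7
  have d8 := catalan_succ_eq 8
  have d9 := catalan_succ_eq 9
  have d10 := catalan_succ_eq 10
  have d11 := catalan_succ_eq 11
  -- For each `n` from `4` to `12` the bound `C n - 2 C (n-1)` alone falls short of `F n`; these
  -- intersections close the gap.
  have e4 := card_inter_even 0
  have e5 := card_inter_five
  have e6 := card_inter_even 1
  have e7 := card_inter_odd 3
  have e8 := card_inter_even 2
  have e9 := card_inter_odd 4
  have e10 := card_inter_even 3
  have e11 := card_inter_odd 5
  have e12 := card_inter_even 4
  norm_num [catalan_one] at *
  have v4 : catalan 4 = 14 := by omega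
  have v5 : catalan 5 = 42 := by omega
  rw [v4] at e9 e10
  rw [v5] at e11 e12
  rw [c2] at e6
  rw [c3] at e7 e8
  interval_cases n <;> norm_num at main <;> omega

end PermPattern

theorem mainTheorem3 (n : ℕ) (hn : 4 ≤ n) :
    PermPattern.s n 0 PermPattern.p132 < PermPattern.s n 0 PermPattern.p123 := by
  rw [PermPattern.s_p132, PermPattern.s_p123]
  exact PermPattern.card_der132_lt_card_der123 hn
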